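/- Consider the combination network with $H$ relays and $K=\binom{H}{r}$ users, $1\le r\le H$: a server holding $N$ files, each of $B$ independent uniform bits, is connected to each of the $H$ relays by an error-free link, and for each set of $r$ relays there is exactly one user, who is connected to these $r$ relays by error-free links. In the placement phase, before the demands are known, user $k$ copies at most $MB$ of the $NB$ bits of the library, uncoded, into its cache. In the delivery phase each user $k$ demands one file $d_k\in\{1,\dots,N\}$; knowing the demand vector $d$ and the caches, the server sends a message (a function of the library) to each relay, and each relay sends to each user connected to it a message that is a function of what the relay received; each user must recover the file it demands from its cache and the messages of its $r$ relays. A load $R$ is achievable with uncoded placement and cache size $M$ if for every $\varepsilon>0$ there are a file size $B\ge 1$ and a scheme of this kind in which, for every demand vector, each server-to-relay link and each relay-to-user link carries at most $RB$ bits, and each user recovers its file with error probability at most $\varepsilon$. The optimal max-link load $R^\star_{\mathrm u}(M)$ under uncoded placement is the infimum of the achievable loads. Theorem. Let $N\ge K=\binom{H}{r}$, $1\le r\le H\le 2r$ and $0\le M\le N/K$. Then $$R^\star_{\mathrm u}(M)=\frac{K}{H}-\frac{K+1}{2H}\cdot\frac{KM}{N}\qquad\text{if } H<2r,$$ $$R^\star_{\mathrm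 u}(M)=\frac{K(H-1)-\left(\frac{KH+H-K}{2}-1\right)\frac{KM}{N}}{H(H-1)}\qquad\text{if } H=2r.$$ -/

import Mathlib

namespace CombinationNetwork

/-- The users of the combination network with `H` relays: one user for every set of `r` relays
(the set of relays that the user is connected to). There are `H.choose r` users. -/
abbrev User (H r : ℕ) : Type := {S : Finset (Fin H) // S.card = r}

/-- A realization of the library: `N` files of `B` bits each. -/
abbrev Library (N B : ℕ) : Type := Fin N → Fin B → Bool

/-- A demand vector: every user asks for one of the `N` files. -/
abbrev Demand (H r N : ℕ) : Type := User H r → Fin N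

/-- A caching scheme with uncoded placement for files of `B` bits. -/
structure Scheme (H r N B : ℕ) where
  /-- Placement (made before the demands are known): `(i, j) ∈ cache k` means that user `k` copies
  bit `j` of file `i` into its cache. -/
  cache : User H r → Finset (Fin N × Fin B)
  /-- Number of bits that the server sends to relay `h` when the demand vector is `d`. -/
  serverBits : Demand H r N → Fin H → ℕ
  /-- Number of bits that relay `h` sends to user `k` when the demand vector is `d`
  (only used when `k` is connected to `h`). -/
  relayBits : Demand H r N → Fin H → User H r → ℕ
  /-- The message that the server sends to relay `h`, a function of the library. -/
  serverMsg : (d : Demand H r N) → (h : Fin H) → Library N B → (Fin (serverBits d h) → Bool)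
  /-- The message that relay `h` sends to user `k`, a function of what relay `h` received. -/
  relayMsg : (d : Demand H r N) → (h : Fin H) → (k : User H r) →
    (Fin (serverBits d h) → Bool) → (Fin (relayBits d h k) → Bool)
  /-- User `k` forms its estimate of the file it wants from the bits in its cache and from the
  messages of the relays that it is connected to. -/
  decode : (d : Demand H r N) → (k : User H r) → ({b // b ∈ cache k} → Bool) →
    ((h : {h // h ∈ k.1}) → Fin (relayBits d h.1 k) → Bool) → (Fin B → Bool)

namespace Scheme

variable {H r N B : ℕ}

/-- Every user stores at most `M * B` bits. -/
def FitsMemory (s : Scheme H r N B) (M : ℝ) : Prop :=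
  ∀ k : User H r, ((s.cache k).card : ℝ) ≤ M * B

/-- For every demand vector, every link of the network (server to relay, and relay to connected
user) carries at most `R * B` bits, that is, the max-link load is at most `R`. -/
def LoadAtMost (s : Scheme H r N B) (R : ℝ) : Prop :=
  ∀ (d : Demand H r N) (h : Fin H),
    (s.serverBits d h : ℝ) ≤ R * B ∧
      ∀ k : User H r, h ∈ k.1 → (s.relayBits d h k : ℝ) ≤ R * B

/-- The estimate of user `k` when the demand vector is `d` and the library is `F`. -/
def estimate (s : Scheme H r N B) (d : Demand H r N) (k : User H r) (F : Library N B) :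
    Fin B → Bool :=
  s.decode d k (fun b => F b.1.1 b.1.2) (fun h => s.relayMsg d h.1 k (s.serverMsg d h.1 F))

/-- The probability that user `k` does not recover its file when the demand vector is `d`; the bits
of the library are independent and uniform. -/
noncomputable def errorProb (s : Scheme H r N B) (d : Demand H r N) (k : User H r) : ℝ :=
  ((Finset.univ.filter fun F : Library N B => s.estimate d k F ≠ F (d k)).card : ℝ) /
    (Fintype.card (Library N B) : ℝ)

end Scheme

/-- The max-link loads that are achievable with uncoded placement and cache size `M` files: for
every `ε > 0` there are a file size `B ≥ 1` and a scheme with uncoded placement, of memory at most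
`M * B` bits per user and max-link load at most `R`, in which for each demand vector each user
recovers its file with probability at least `1 - ε`. -/
def achievableLoads (H r N : ℕ) (M : ℝ) : Set ℝ :=
  {R | ∀ ε : ℝ, 0 < ε → ∃ B : ℕ, 1 ≤ B ∧ ∃ s : Scheme H r N B,
    s.FitsMemory M ∧ s.LoadAtMost R ∧ ∀ (d : Demand H r N) (k : User H r), s.errorProb d k ≤ ε}

/-- `R` is the optimal max-link load under uncoded placement with cache size `M` files: the
infimum of the achievable max-link loads. -/
def IsOptimalLoad (H r N : ℕ) (M R : ℝ) : Prop := IsGLB (achievableLoads H r N M) R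

end CombinationNetwork

/-! Write K for the number of users and q = KM/N.

Achievability. Both formulas are affine in q, so memory sharing reduces to q = 0, where files are
sent uncoded, and q = 1. At q = 1 every bit is cached by exactly one user, and each ordered pair of
users is assigned symbols, each the sum of a piece wanted by one and cached by the other and of a
piece with these roles exchanged; both users have to learn these symbols. If H < 2r, any two users
share a relay, which forwards them. If H = 2r, complementary users share no relay, but a vector over
the relays with total zero has opposite sums over S and over its complement, so both users learn the
same symbol. Its H entries carry H - 1 free symbols (`exists_prescribed_sums`), and relabelling by
all permutations of the relays treats all pairs alike (`hasCode_cached_of_eq`).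

Converse. Only libraries on which no user errs are kept; by `exists_error_bound` this loses a
bounded number of bits. Serving the users in a fixed order gives an acyclic index-coding bound
(`acyclic_bound`). An order and its reverse together give weight 2 to an uncached bit and 1 to a bit
cached by a single other user, which is tight for H < 2r. For H = 2r a complementary pair costs H/(H
- 1) times as much. This is detected by leaving out one relay at a time and recombining the H
resulting entropies with a Han-type inequality (`sum_le_sum_levelSet`, `omit_one_relay_bound`):
uncached bits get weight 2(H - 1), meeting pairs H - 1, complementary pairs H. Averaging over
demands turns such weights into a bound linear in M (`load_bound_of_distinct_demands`). -/

namespace CombinationNetwork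

/-! ### Conditional entropy by counting fibers -/

open scoped Classical in
/-- The elements of `G` on which the variables indexed by `s` take the same values as at `ω`. -/
noncomputable def fiber {Ω ι γ : Type*} (G : Finset Ω) (v : ι → Ω → γ) (s : Set ι) (ω : Ω) :
    Finset Ω :=
  G.filter fun ω' => ∀ i ∈ s, v i ω' = v i ω

/-- The conditional entropy, in nats, of a uniformly distributed element of `G` given the
variables indexed by `s`. -/
noncomputable def condEntropy {Ω ι γ : Type*} (G : Finset Ω) (v : ι → Ω → γ) (s : Set ι) : ℝ :=
  (∑ ω ∈ G, Real.log ((fiber G v s ω).card : ℝ)) / (G.card : ℝ)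

section Entropy

variable {Ω ι γ : Type*} {G : Finset Ω} {v : ι → Ω → γ} {s t : Set ι} {ω ω' : Ω}

lemma mem_fiber : ω' ∈ fiber G v s ω ↔ ω' ∈ G ∧ ∀ i ∈ s, v i ω' = v i ω := by
  simp [fiber]

lemma self_mem_fiber (h : ω ∈ G) : ω ∈ fiber G v s ω := mem_fiber.2 ⟨h, fun _ _ => rfl⟩

lemma fiber_card_pos (h : ω ∈ G) : 0 < ((fiber G v s ω).card : ℝ) := by
  exact_mod_cast Finset.card_pos.2 ⟨ω, self_mem_fiber h⟩

lemma fiber_eq_of_mem (h : ω' ∈ fiber G v s ω) : fiber G v s ω' = fiber G v s ω := by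
  ext x
  simp only [mem_fiber] at h ⊢
  exact and_congr_right fun _ => forall₂_congr fun i hi => by rw [h.2 i hi]

lemma mem_fiber_comm (hω : ω ∈ G) (hω' : ω' ∈ G) :
    ω' ∈ fiber G v s ω ↔ ω ∈ fiber G v s ω' := by
  simp only [mem_fiber, hω, hω', true_and]
  exact forall₂_congr fun i _ => eq_comm

lemma fiber_anti (h : s ⊆ t) : fiber G v t ω ⊆ fiber G v s ω := fun x hx => by
  simp only [mem_fiber] at hx ⊢
  exact ⟨hx.1, fun i hi => hx.2 i (h hi)⟩

lemma fiber_subset (ω : Ω) : fiber G v s ω ⊆ G := fun _ hx => (mem_fiber.1 hx).1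

lemma condEntropy_le_of_fiber_subset (h : ∀ ω ∈ G, fiber G v s ω ⊆ fiber G v t ω) :
    condEntropy G v s ≤ condEntropy G v t := by
  refine div_le_div_of_nonneg_right (Finset.sum_le_sum fun ω hω => ?_) (by positivity)
  exact Real.log_le_log (fiber_card_pos hω) (by exact_mod_cast Finset.card_le_card (h ω hω))

lemma condEntropy_empty (hG : G.Nonempty) : condEntropy G v ∅ = Real.log G.card := by
  have : ∀ ω, fiber G v ∅ ω = G := fun ω => by ext x; simp [mem_fiber]
  have hc : (G.card : ℝ) ≠ 0 := by exact_mod_cast hG.card_pos.ne'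
  simp only [condEntropy, this, Finset.sum_const, nsmul_eq_mul]
  field_simp

lemma condEntropy_nonpos_of_determined
    (h : ∀ ω ∈ G, ∀ ω' ∈ G, (∀ i ∈ s, v i ω' = v i ω) → ω' = ω) :
    condEntropy G v s ≤ 0 := by
  refine div_nonpos_of_nonpos_of_nonneg (Finset.sum_nonpos fun ω hω => ?_) (by positivity)
  refine Real.log_nonpos (by positivity) ?_
  have : fiber G v s ω ⊆ {ω} := fun x hx => by
    simpa using h ω hω x (fiber_subset _ hx) (mem_fiber.1 hx).2
  exact_mod_cast (Finset.card_le_card this).trans (by simp)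

lemma sum_sum_fiber_swap (f : Ω → Ω → ℝ) :
    ∑ ω ∈ G, ∑ ω' ∈ fiber G v s ω, f ω ω' = ∑ ω' ∈ G, ∑ ω ∈ fiber G v s ω', f ω ω' := by
  refine Finset.sum_comm' fun x y => ?_
  constructor
  · rintro ⟨hx, hy⟩
    exact ⟨(mem_fiber_comm hx (fiber_subset _ hy)).1 hy, fiber_subset _ hy⟩
  · rintro ⟨hx, hy⟩
    exact ⟨fiber_subset _ hx, (mem_fiber_comm hy (fiber_subset _ hx)).1 hx⟩

/-- Jensen's inequality for the logarithm, from its tangent line at `m`. -/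
lemma log_sum_le {f : Ω → ℝ} {m : ℝ} (hm : 0 < m) (hf : ∀ ω ∈ G, 0 < f ω)
    (h : ∑ ω ∈ G, f ω ≤ m * G.card) : ∑ ω ∈ G, Real.log (f ω) ≤ G.card * Real.log m := by
  have : ∀ ω ∈ G, Real.log (f ω) ≤ f ω / m - 1 + Real.log m := fun ω hω => by
    have := Real.log_le_sub_one_of_pos (div_pos (hf ω hω) hm)
    rw [Real.log_div (hf ω hω).ne' hm.ne'] at this
    linarith
  refine (Finset.sum_le_sum this).trans ?_
  rw [Finset.sum_add_distrib, Finset.sum_sub_distrib, ← Finset.sum_div]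
  have h2 : (∑ ω ∈ G, f ω) / m ≤ G.card := by
    rw [div_le_iff₀ hm]; linarith
  simp only [Finset.sum_const, nsmul_eq_mul, mul_one]
  linarith

/-- Since ω determines all the variables, `condEntropy G v s` is log |G| minus the joint entropy of
the variables in `s`; submodularity of entropy thus appears with the inequality reversed. -/
lemma condEntropy_submodular (G : Finset Ω) (v : ι → Ω → γ) (s t : Set ι) :
    condEntropy G v s + condEntropy G v t ≤
      condEntropy G v (s ∪ t) + condEntropy G v (s ∩ t) := by
  classical
  set a : Set ι → Ω → ℝ := fun s ω => ((fiber G v s ω).card : ℝ) with ha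
  have hpos : ∀ s, ∀ ω ∈ G, 0 < a s ω := fun s ω hω => fiber_card_pos hω
  -- Double counting of triples (ω, α, β) in which α agrees with ω on `s` and β agrees with ω on
  -- `t`. For fixed α and β the possible ω form a single fiber of `s ∪ t` or nothing, and they exist
  -- only if α and β agree on `s ∩ t`.
  have key : ∑ ω ∈ G, a s ω * a t ω / (a (s ∪ t) ω * a (s ∩ t) ω) ≤ 1 * G.card := by
    calc ∑ ω ∈ G, a s ω * a t ω / (a (s ∪ t) ω * a (s ∩ t) ω)
        = ∑ ω ∈ G, ∑ α ∈ fiber G v s ω, ∑ β ∈ G,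
            if β ∈ fiber G v t ω then (a (s ∩ t) α)⁻¹ * (a (s ∪ t) ω)⁻¹ else 0 := by
          refine Finset.sum_congr rfl fun ω hω => ?_
          have h1 : ∀ α ∈ fiber G v s ω, (∑ β ∈ G,
              if β ∈ fiber G v t ω then (a (s ∩ t) α)⁻¹ * (a (s ∪ t) ω)⁻¹ else 0) =
              a t ω * ((a (s ∩ t) ω)⁻¹ * (a (s ∪ t) ω)⁻¹) := fun α hα => by
            rw [← Finset.sum_filter, Finset.filter_mem_eq_inter,
              Finset.inter_eq_right.2 (fiber_subset ω), Finset.sum_const, nsmul_eq_mul]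
            have : a (s ∩ t) α = a (s ∩ t) ω := by
              simp only [ha]
              rw [fiber_eq_of_mem (fiber_anti Set.inter_subset_left hα)]
            rw [this]
          rw [Finset.sum_congr rfl h1, Finset.sum_const, nsmul_eq_mul]
          simp only [ha, div_eq_mul_inv, mul_inv]
          ring
      _ = ∑ α ∈ G, ∑ ω ∈ fiber G v s α, ∑ β ∈ G,
            if β ∈ fiber G v t ω then (a (s ∩ t) α)⁻¹ * (a (s ∪ t) ω)⁻¹ else 0 :=
          sum_sum_fiber_swap _
      _ = ∑ α ∈ G, ∑ β ∈ G, ∑ ω ∈ fiber G v s α,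
            if β ∈ fiber G v t ω then (a (s ∩ t) α)⁻¹ * (a (s ∪ t) ω)⁻¹ else 0 :=
          Finset.sum_congr rfl fun α _ => Finset.sum_comm
      _ ≤ ∑ α ∈ G, ∑ β ∈ G, if β ∈ fiber G v (s ∩ t) α then (a (s ∩ t) α)⁻¹ else 0 := by
          refine Finset.sum_le_sum fun α hα => Finset.sum_le_sum fun β hβ => ?_
          rw [← Finset.sum_filter]
          by_cases hne : ((fiber G v s α).filter fun ω => β ∈ fiber G v t ω).Nonempty
          · obtain ⟨ω₀, h₀⟩ := hne
            obtain ⟨h1, h2⟩ := Finset.mem_filter.1 h₀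
            have hω₀ := fiber_subset _ h1
            have hβ' : β ∈ fiber G v (s ∩ t) α := by
              rw [← fiber_eq_of_mem (fiber_anti Set.inter_subset_left h1)]
              exact fiber_anti Set.inter_subset_right h2
            have hset : ((fiber G v s α).filter fun ω => β ∈ fiber G v t ω) =
                fiber G v (s ∪ t) ω₀ := by
              ext x
              rw [Finset.mem_filter, ← fiber_eq_of_mem h1]
              constructor
              · rintro ⟨hx1, hx2⟩
                have hxG := fiber_subset _ hx1
                have hx3 := (mem_fiber_comm hxG hβ).1 hx2
                refine mem_fiber.2 ⟨hxG, ?_⟩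
                rintro i (hi | hi)
                · exact (mem_fiber.1 hx1).2 i hi
                · rw [(mem_fiber.1 hx3).2 i hi, (mem_fiber.1 h2).2 i hi]
              · intro hx
                refine ⟨fiber_anti Set.subset_union_left hx, ?_⟩
                rwa [fiber_eq_of_mem (fiber_anti Set.subset_union_right hx)]
            rw [hset, if_pos hβ', ← Finset.mul_sum]
            have : ∑ ω ∈ fiber G v (s ∪ t) ω₀, (a (s ∪ t) ω)⁻¹ = 1 := by
              rw [Finset.sum_congr rfl (g := fun _ => (a (s ∪ t) ω₀)⁻¹)]
              · rw [Finset.sum_const, nsmul_eq_mul]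
                exact mul_inv_cancel₀ (hpos _ _ hω₀).ne'
              · intro ω hω
                simp only [ha]
                rw [fiber_eq_of_mem hω]
            rw [this, mul_one]
          · rw [Finset.not_nonempty_iff_eq_empty.1 hne, Finset.sum_empty]
            split_ifs
            · exact inv_nonneg.2 (hpos _ _ hα).le
            · exact le_rfl
      _ = 1 * G.card := by
          rw [one_mul, Finset.cast_card]
          refine Finset.sum_congr rfl fun α hα => ?_
          rw [← Finset.sum_filter, Finset.filter_mem_eq_inter,
            Finset.inter_eq_right.2 (fiber_subset α), Finset.sum_const, nsmul_eq_mul]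
          exact mul_inv_cancel₀ (hpos _ _ hα).ne'
  have hlog := log_sum_le one_pos (fun ω hω => div_pos (mul_pos (hpos s ω hω) (hpos t ω hω))
    (mul_pos (hpos (s ∪ t) ω hω) (hpos (s ∩ t) ω hω))) key
  rw [Real.log_one, mul_zero, Finset.sum_congr rfl (fun ω hω => show _ =
    (Real.log (a s ω) + Real.log (a t ω)) -
      (Real.log (a (s ∪ t) ω) + Real.log (a (s ∩ t) ω)) by
    rw [Real.log_div (mul_pos (hpos s ω hω) (hpos t ω hω)).ne'
      (mul_pos (hpos (s ∪ t) ω hω) (hpos (s ∩ t) ω hω)).ne',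
      Real.log_mul (hpos s ω hω).ne' (hpos t ω hω).ne',
      Real.log_mul (hpos (s ∪ t) ω hω).ne' (hpos (s ∩ t) ω hω).ne'])] at hlog
  simp only [Finset.sum_sub_distrib, Finset.sum_add_distrib] at hlog
  simp only [condEntropy, ← add_div]
  exact div_le_div_of_nonneg_right (by simpa only [ha] using sub_nonpos.1 hlog) (by positivity)

/-- Each fiber of `s` splits into at most `m` fibers of `insert i s`, so the mean ratio of their
sizes is at most `m`; then Jensen applies. -/
lemma condEntropy_le_insert [DecidableEq γ] (i : ι) (m : ℕ) (hm : 0 < m)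
    (hv : (G.image (v i)).card ≤ m) :
    condEntropy G v s ≤ condEntropy G v (insert i s) + Real.log m := by
  rcases G.eq_empty_or_nonempty with rfl | hG
  · simp only [condEntropy, Finset.sum_empty, zero_div, zero_add]
    exact Real.log_natCast_nonneg m
  set a : Set ι → Ω → ℝ := fun s ω => ((fiber G v s ω).card : ℝ) with ha
  have hpos : ∀ s, ∀ ω ∈ G, 0 < a s ω := fun s ω hω => fiber_card_pos hω
  have key : ∑ ω ∈ G, a s ω / a (insert i s) ω ≤ m * G.card := by
    calc ∑ ω ∈ G, a s ω / a (insert i s) ω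
        = ∑ ω ∈ G, ∑ _α ∈ fiber G v s ω, (a (insert i s) ω)⁻¹ := by
          simp only [Finset.sum_const, nsmul_eq_mul, div_eq_mul_inv, ha]
      _ = ∑ α ∈ G, ∑ ω ∈ fiber G v s α, (a (insert i s) ω)⁻¹ := sum_sum_fiber_swap _
      _ ≤ ∑ α ∈ G, (m : ℝ) := by
          refine Finset.sum_le_sum fun α _ => ?_
          rw [← Finset.sum_fiberwise_of_maps_to (t := G.image (v i)) (g := v i)
            (fun x hx => Finset.mem_image_of_mem _ (fiber_subset _ hx))]
          refine (Finset.sum_le_card_nsmul _ _ 1 fun y _ => ?_).trans ?_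
          · by_cases hne : ((fiber G v s α).filter fun ω => v i ω = y).Nonempty
            · obtain ⟨ω₀, h₀⟩ := hne
              obtain ⟨h1, h2⟩ := Finset.mem_filter.1 h₀
              have hset : ((fiber G v s α).filter fun ω => v i ω = y) =
                  fiber G v (insert i s) ω₀ := by
                ext x
                rw [← fiber_eq_of_mem h1, ← h2]
                simp only [Finset.mem_filter, mem_fiber, Set.forall_mem_insert]
                tauto
              rw [hset, Finset.sum_congr rfl (g := fun _ => (a (insert i s) ω₀)⁻¹)]
              · rw [Finset.sum_const, nsmul_eq_mul]
                exact (mul_inv_cancel₀ (hpos _ _ (fiber_subset _ h1)).ne').le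
              · intro ω hω
                simp only [ha]
                rw [fiber_eq_of_mem hω]
            · rw [Finset.not_nonempty_iff_eq_empty.1 hne, Finset.sum_empty]
              exact zero_le_one
          · rw [nsmul_eq_mul, mul_one]
            exact_mod_cast hv
      _ = m * G.card := by rw [Finset.sum_const, nsmul_eq_mul, mul_comm]
  have hlog := log_sum_le (by exact_mod_cast hm) (fun ω hω => div_pos (hpos s ω hω)
    (hpos (insert i s) ω hω)) key
  rw [Finset.sum_congr rfl (fun ω hω => Real.log_div (hpos s ω hω).ne'
    (hpos (insert i s) ω hω).ne'), Finset.sum_sub_distrib] at hlog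
  have hc : (0 : ℝ) < G.card := by exact_mod_cast hG.card_pos
  rw [← sub_le_iff_le_add', condEntropy, condEntropy, ← sub_div, div_le_iff₀ hc]
  simp only [ha] at hlog
  linarith

lemma condEntropy_le_union [DecidableEq γ] (I : Finset ι) (m : ι → ℕ) (hm : ∀ i ∈ I, 0 < m i)
    (hv : ∀ i ∈ I, (G.image (v i)).card ≤ m i) :
    condEntropy G v s ≤ condEntropy G v (s ∪ ↑I) + ∑ i ∈ I, Real.log (m i) := by
  classical
  induction I using Finset.induction_on with
  | empty => simp
  | insert i I hi ih =>
    rw [Finset.sum_insert hi, Finset.coe_insert, Set.union_insert]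
    have h1 := ih (fun j hj => hm j (Finset.mem_insert_of_mem hj))
      (fun j hj => hv j (Finset.mem_insert_of_mem hj))
    have h2 := condEntropy_le_insert (s := s ∪ ↑I) i (m i) (hm i (Finset.mem_insert_self _ _))
      (hv i (Finset.mem_insert_self _ _))
    linarith

end Entropy

/-! ### A Han-type inequality for level sets -/

section LevelSets

variable {ι κ : Type*}

open scoped Classical in
/-- The elements that lie in at least `j` of the sets `s h`, `h ∈ T`. -/
def levelSet (s : κ → Set ι) (T : Finset κ) (j : ℕ) : Set ι :=
  {x | j ≤ (T.filter fun h => x ∈ s h).card}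

lemma levelSet_anti (s : κ → Set ι) (T : Finset κ) {i j : ℕ} (h : i ≤ j) :
    levelSet s T j ⊆ levelSet s T i := fun _ hx => h.trans hx

lemma levelSet_eq_empty (s : κ → Set ι) (T : Finset κ) {j : ℕ} (h : T.card < j) :
    levelSet s T j = ∅ := by
  classical
  refine Set.eq_empty_of_forall_notMem fun x hx => ?_
  have : j ≤ (T.filter fun h => x ∈ s h).card := hx
  have := Finset.card_filter_le T (fun h => x ∈ s h)
  omega

lemma levelSet_insert [DecidableEq κ] (s : κ → Set ι) {T : Finset κ} {h : κ} (hh : h ∉ T)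
    (j : ℕ) : levelSet s (insert h T) (j + 1) =
      levelSet s T (j + 1) ∪ (levelSet s T j ∩ s h) := by
  classical
  ext x
  simp only [levelSet, Set.mem_ofPred_eq, Set.mem_union, Set.mem_inter_iff,
    Finset.filter_insert]
  by_cases hx : x ∈ s h
  · rw [if_pos hx, Finset.card_insert_of_notMem (by simp [hh])]
    simp only [hx, and_true]
    omega
  · simp [hx]

/-- Replacing two sets by their union and intersection does not decrease the sum, and it preserves
how often each element is covered. Repeated uncrossing leads to a chain, which consists of the level
sets. -/
lemma sum_le_sum_levelSet (f : Set ι → ℝ) (hf : ∀ s t, f s + f t ≤ f (s ∪ t) + f (s ∩ t))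
    (s : κ → Set ι) (T : Finset κ) :
    ∑ h ∈ T, f (s h) ≤ ∑ j ∈ Finset.range T.card, f (levelSet s T (j + 1)) := by
  classical
  induction T using Finset.induction_on with
  | empty => simp
  | insert h T hh ih =>
    -- The new set is uncrossed with the levels one by one; after `m` levels the part still carried
    -- upwards is `levelSet s T m ∩ s h`.
    have step : ∀ m, ∑ j ∈ Finset.range m, f (levelSet s T (j + 1)) + f (s h) ≤
        ∑ j ∈ Finset.range m, f (levelSet s (insert h T) (j + 1)) +
          f (levelSet s T m ∩ s h) := by
      intro m
      induction m with
      | zero => simp [levelSet]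
      | succ m ihm =>
        rw [Finset.sum_range_succ, Finset.sum_range_succ, levelSet_insert s hh]
        have := hf (levelSet s T (m + 1)) (levelSet s T m ∩ s h)
        rw [← Set.inter_assoc, Set.inter_eq_left.2 (levelSet_anti s T m.le_succ)] at this
        linarith
    rw [Finset.sum_insert hh, Finset.card_insert_of_notMem hh, Finset.sum_range_succ,
      levelSet_insert s hh, levelSet_eq_empty s T (Nat.lt_succ_self _), Set.empty_union]
    linarith [step T.card]

end LevelSets

end CombinationNetwork

/-! ### Entropy bounds for a fixed scheme and demand vector -/

namespace CombinationNetwork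

namespace Scheme

variable {H r N B : ℕ}

open scoped Classical in
/-- The libraries for which every user recovers its file when the demand vector is `d`. -/
noncomputable def goodLibraries (s : Scheme H r N B) (d : Demand H r N) : Finset (Library N B) :=
  Finset.univ.filter fun F => ∀ k, s.estimate d k F = F (d k)

/-- The messages of the server to the relays and the bits of the library, as one family of
random variables. -/
def var (s : Scheme H r N B) (d : Demand H r N) :
    Fin H ⊕ (Fin N × Fin B) → Library N B → List Bool
  -- Lists give messages of different lengths and single bits a common value type.
  | Sum.inl h, F => List.ofFn (s.serverMsg d h F)
  | Sum.inr b, F => [F b.1 b.2]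

/-- The users that cache a given bit. -/
def cachers (s : Scheme H r N B) (b : Fin N × Fin B) : Finset (User H r) :=
  Finset.univ.filter fun k => b ∈ s.cache k

lemma mem_cachers {s : Scheme H r N B} {b : Fin N × Fin B} {k : User H r} :
    k ∈ s.cachers b ↔ b ∈ s.cache k := by
  simp [cachers]

end Scheme

/-- The index set of the messages to the relays in `A` and of the library bits in `I`. -/
def varSet {H N B : ℕ} (A : Set (Fin H)) (I : Set (Fin N × Fin B)) :
    Set (Fin H ⊕ (Fin N × Fin B)) :=
  {x | Sum.elim (· ∈ A) (· ∈ I) x}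

section Converse

variable {H r N B : ℕ} {s : Scheme H r N B} {d : Demand H r N}

@[simp] lemma inl_mem_varSet {A : Set (Fin H)} {I : Set (Fin N × Fin B)} {h : Fin H} :
    Sum.inl h ∈ varSet A I ↔ h ∈ A := Iff.rfl

@[simp] lemma inr_mem_varSet {A : Set (Fin H)} {I : Set (Fin N × Fin B)} {b : Fin N × Fin B} :
    Sum.inr b ∈ varSet A I ↔ b ∈ I := Iff.rfl

lemma var_inl_inj {h : Fin H} {F F' : Library N B} :
    s.var d (Sum.inl h) F = s.var d (Sum.inl h) F' ↔ s.serverMsg d h F = s.serverMsg d h F' :=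
  List.ofFn_injective.eq_iff

lemma var_inr_inj {b : Fin N × Fin B} {F F' : Library N B} :
    s.var d (Sum.inr b) F = s.var d (Sum.inr b) F' ↔ F b.1 b.2 = F' b.1 b.2 := by
  simp [Scheme.var]

lemma mem_goodLibraries {F : Library N B} :
    F ∈ s.goodLibraries d ↔ ∀ k, s.estimate d k F = F (d k) := by
  simp [Scheme.goodLibraries]

lemma goodLibraries_determined {F F' : Library N B} (hF : F ∈ s.goodLibraries d)
    (hF' : F' ∈ s.goodLibraries d) {k : User H r}
    (hc : ∀ b ∈ s.cache k, F b.1 b.2 = F' b.1 b.2)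
    (hm : ∀ h ∈ k.1, s.serverMsg d h F = s.serverMsg d h F') : F (d k) = F' (d k) := by
  rw [← mem_goodLibraries.1 hF k, ← mem_goodLibraries.1 hF' k]
  unfold Scheme.estimate
  congr 1
  · funext b
    exact hc b.1 b.2
  · funext h
    rw [hm h.1 h.2]

/-- Successive decoding in the order of `ρ`: each cached bit of a user is either given or lies in a
file that an earlier user has already recovered. The relay messages play no role, being functions of
the server messages. -/
lemma files_determined {F F' : Library N B} (hF : F ∈ s.goodLibraries d)
    (hF' : F' ∈ s.goodLibraries d) {A : Set (Fin H)} {I : Set (Fin N × Fin B)}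
    (hv : ∀ x ∈ varSet A I, s.var d x F = s.var d x F') (ρ : User H r → ℕ)
    (hI : ∀ S : User H r, (S.1 : Set (Fin H)) ⊆ A → ∀ b ∈ s.cache S,
      b ∈ I ∨ ∃ U : User H r, (U.1 : Set (Fin H)) ⊆ A ∧ d U = b.1 ∧ ρ U < ρ S)
    (S : User H r) (hS : (S.1 : Set (Fin H)) ⊆ A) : F (d S) = F' (d S) := by
  induction hn : ρ S using Nat.strong_induction_on generalizing S with
  | _ n ih =>
    refine goodLibraries_determined hF hF' (fun b hb => ?_) fun h hh =>
      var_inl_inj.1 (hv (Sum.inl h) (hS hh))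
    rcases hI S hS b hb with h | ⟨U, hU, hdU, hlt⟩
    · exact var_inr_inj.1 (hv (Sum.inr b) h)
    · have := ih (ρ U) (hn ▸ hlt) U hU rfl
      rw [hdU] at this
      rw [this]

lemma card_image_var_inl (G : Finset (Library N B)) (h : Fin H) :
    (G.image (s.var d (Sum.inl h))).card ≤ 2 ^ s.serverBits d h := by
  have : G.image (s.var d (Sum.inl h)) ⊆
      (Finset.univ : Finset (Fin (s.serverBits d h) → Bool)).image List.ofFn := by
    intro x hx
    obtain ⟨F, -, rfl⟩ := Finset.mem_image.1 hx
    exact Finset.mem_image_of_mem _ (Finset.mem_univ (s.serverMsg d h F))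
  refine (Finset.card_le_card this).trans (Finset.card_image_le.trans ?_)
  simp

lemma card_image_var_inr (G : Finset (Library N B)) (b : Fin N × Fin B) :
    (G.image (s.var d (Sum.inr b))).card ≤ 2 := by
  have : G.image (s.var d (Sum.inr b)) ⊆ (Finset.univ : Finset Bool).image (fun x => [x]) := by
    intro x hx
    obtain ⟨F, -, rfl⟩ := Finset.mem_image.1 hx
    exact Finset.mem_image_of_mem _ (Finset.mem_univ (F b.1 b.2))
  refine (Finset.card_le_card this).trans (Finset.card_image_le.trans ?_)
  simp

/-- The conditional entropy of the library given some of the messages and of its bits. -/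
noncomputable def Scheme.ent (s : Scheme H r N B) (d : Demand H r N)
    (x : Set (Fin H ⊕ (Fin N × Fin B))) : ℝ :=
  condEntropy (s.goodLibraries d) (s.var d) x

lemma ent_le_add_bits (A : Set (Fin H)) (I : Set (Fin N × Fin B)) (I' : Finset (Fin N × Fin B)) :
    s.ent d (varSet A I) ≤ s.ent d (varSet A (I ∪ ↑I')) + I'.card * Real.log 2 := by
  have h := condEntropy_le_union (G := s.goodLibraries d) (v := s.var d) (s := varSet A I)
    (I'.map Function.Embedding.inr) (fun _ => 2) (fun _ _ => two_pos) (fun i hi => by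
      obtain ⟨b, -, rfl⟩ := Finset.mem_map.1 hi
      exact card_image_var_inr _ b)
  have e : varSet A I ∪
      ((I'.map Function.Embedding.inr : Finset (Fin H ⊕ (Fin N × Fin B))) : Set _) =
      varSet A (I ∪ ↑I') := by
    ext x
    rcases x with h | b <;> simp
  rw [e, Finset.sum_const, Finset.card_map, nsmul_eq_mul] at h
  simpa only [Scheme.ent, Nat.cast_ofNat] using h

lemma ent_le_add_msgs (A : Finset (Fin H)) :
    s.ent d ∅ ≤ s.ent d (varSet ↑A ∅) + (∑ h ∈ A, s.serverBits d h : ℕ) * Real.log 2 := by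
  have h := condEntropy_le_union (G := s.goodLibraries d) (v := s.var d) (s := ∅)
    (A.map Function.Embedding.inl) (Sum.elim (fun h => 2 ^ s.serverBits d h) fun _ => 1)
    (fun x hx => by
      obtain ⟨b, -, rfl⟩ := Finset.mem_map.1 hx
      exact Nat.two_pow_pos _) (fun i hi => by
      obtain ⟨b, -, rfl⟩ := Finset.mem_map.1 hi
      exact card_image_var_inl _ b)
  have e : ∅ ∪ ((A.map Function.Embedding.inl : Finset (Fin H ⊕ (Fin N × Fin B))) : Set _) =
      varSet (N := N) (B := B) (↑A : Set (Fin H)) ∅ := by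
    ext x
    rcases x with h | b <;> simp
  rw [e, Finset.sum_map] at h
  refine h.trans (le_of_eq ?_)
  rw [Nat.cast_sum, Finset.sum_mul]
  simp [Scheme.ent]

lemma log_card_goodLibraries_le (hG : (s.goodLibraries d).Nonempty) (A : Finset (Fin H))
    (I : Finset (Fin N × Fin B)) :
    Real.log (s.goodLibraries d).card ≤ s.ent d (varSet ↑A ↑I) +
      ((∑ h ∈ A, s.serverBits d h : ℕ) + I.card) * Real.log 2 := by
  classical
  have h1 := ent_le_add_msgs (s := s) (d := d) A
  have h2 := ent_le_add_bits (s := s) (d := d) (↑A) ∅ I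
  rw [Scheme.ent, condEntropy_empty hG] at h1
  rw [Set.empty_union] at h2
  linarith

/-- The bits in the acyclic part of the demanded files: the users are served in the order of `ρ`,
and a bit counts if it is not cached at all or only by one user who is served later. -/
def Scheme.acyclicBits (s : Scheme H r N B) (d : Demand H r N) (ρ : User H r → ℕ) :
    Set (Fin N × Fin B) :=
  {b | ∃ U, d U = b.1 ∧ (s.cachers b = ∅ ∨ ∃ V, s.cachers b = {V} ∧ ρ U < ρ V)}

lemma ent_nonpos_of_acyclicBits_compl (ρ : User H r → ℕ) {I : Set (Fin N × Fin B)}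
    (hI : (s.acyclicBits d ρ)ᶜ ⊆ I) : s.ent d (varSet Set.univ I) ≤ 0 := by
  refine condEntropy_nonpos_of_determined fun F hF F' hF' hv => ?_
  have hfile := files_determined hF' hF hv ρ (fun S _ b hb => ?_)
  · funext i
    funext j
    by_cases hb : (i, j) ∈ s.acyclicBits d ρ
    · obtain ⟨U, hU, -⟩ := hb
      have := hfile U (Set.subset_univ _)
      rw [hU] at this
      exact congrFun this j
    · exact var_inr_inj.1 (hv (Sum.inr (i, j)) (hI hb))
  · by_cases hbD : b ∈ s.acyclicBits d ρ
    · obtain ⟨U, hU, h | ⟨V, hV, hlt⟩⟩ := hbD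
      · exact absurd (Scheme.mem_cachers.2 hb) (by simp [h])
      · have : S ∈ s.cachers b := Scheme.mem_cachers.2 hb
        rw [hV, Finset.mem_singleton] at this
        exact Or.inr ⟨U, Set.subset_univ _, hU, this ▸ hlt⟩
    · exact Or.inl (hI hbD)

open scoped Classical in
lemma ent_le_card_bits (ρ : User H r → ℕ) (I : Set (Fin N × Fin B)) :
    s.ent d (varSet Set.univ I) ≤
      (Finset.univ.filter fun b => b ∉ s.acyclicBits d ρ ∧ b ∉ I).card * Real.log 2 := by
  refine (ent_le_add_bits _ I
    (Finset.univ.filter fun b => b ∉ s.acyclicBits d ρ ∧ b ∉ I)).trans ?_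
  refine add_le_of_nonpos_left (ent_nonpos_of_acyclicBits_compl ρ fun b hb => ?_)
  by_cases h : b ∈ I
  · exact Or.inl h
  · exact Or.inr (by simpa using ⟨hb, h⟩)

open scoped Classical in
/-- The acyclic index-coding bound for the messages to all the relays. -/
lemma acyclic_bound (hG : (s.goodLibraries d).Nonempty) (ρ : User H r → ℕ) :
    Real.log (s.goodLibraries d).card ≤
      ((∑ h, s.serverBits d h : ℕ) +
        (Finset.univ.filter fun b => b ∉ s.acyclicBits d ρ).card) * Real.log 2 := by
  have h := log_card_goodLibraries_le hG Finset.univ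
    (Finset.univ.filter fun b => b ∉ s.acyclicBits d ρ)
  have h2 := ent_nonpos_of_acyclicBits_compl (s := s) (d := d) ρ
    (I := ↑(Finset.univ.filter fun b => b ∉ s.acyclicBits d ρ)) (fun b hb => by simpa using hb)
  rw [Finset.coe_univ] at h
  linarith

/-- The bits that are not given for free to the users who are not connected to relay `h`. -/
def Scheme.withheldBits (s : Scheme H r N B) (d : Demand H r N) (ρ : User H r → ℕ) (h : Fin H) :
    Set (Fin N × Fin B) :=
  {b | ∃ U, d U = b.1 ∧ (s.cachers b = ∅ ∨
    ∃ V, V ≠ U ∧ s.cachers b = {V} ∧ (h ∈ V.1 ∨ (h ∉ U.1 ∧ ρ U < ρ V)))}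

/-- The bits that the users who are not connected to relay `h` are not known to recover. -/
def Scheme.hiddenBits (s : Scheme H r N B) (d : Demand H r N) (h : Fin H) :
    Set (Fin N × Fin B) :=
  {b | ∃ U, d U = b.1 ∧ h ∈ U.1 ∧ (s.cachers b = ∅ ∨
    ∃ V, V ≠ U ∧ s.cachers b = {V} ∧ h ∈ V.1)}

/-- The users that avoid `h` decode one after the other in the order of `ρ` from the other relays
and the bits that are not withheld. Knowing their files for free shrinks the unknown bits from the
withheld ones to the hidden ones. -/
lemma ent_withheldBits_le (ρ : User H r → ℕ) (h : Fin H) :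
    s.ent d (varSet {h}ᶜ (s.withheldBits d ρ h)ᶜ) ≤
      s.ent d (varSet {h}ᶜ (s.hiddenBits d h)ᶜ) := by
  have hsub : ∀ U : User H r, h ∉ U.1 → (U.1 : Set (Fin H)) ⊆ {h}ᶜ := fun U hU x hx hxh =>
    hU (by rw [Set.mem_singleton_iff] at hxh; rwa [← hxh])
  refine condEntropy_le_of_fiber_subset fun F hF F' hF' => ?_
  obtain ⟨hF'G, hv⟩ := mem_fiber.1 hF'
  refine mem_fiber.2 ⟨hF'G, ?_⟩
  have hfile := files_determined hF'G hF hv ρ (fun S hS b hb => ?_)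
  · rintro (h' | b) hx
    · exact hv (Sum.inl h') hx
    · by_cases hw : b ∈ s.withheldBits d ρ h
      · obtain ⟨U, hU, hc⟩ := hw
        rw [var_inr_inj]
        by_cases hhU : h ∈ U.1
        · refine absurd ?_ (inr_mem_varSet.1 hx)
          refine ⟨U, hU, hhU, hc.imp id ?_⟩
          rintro ⟨V, hVU, hV, hh⟩
          exact ⟨V, hVU, hV, hh.resolve_right fun h => h.1 hhU⟩
        · have := hfile U (hsub U hhU)
          rw [hU] at this
          rw [this]
      · exact hv (Sum.inr b) hw
  · by_cases hw : b ∈ s.withheldBits d ρ h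
    · obtain ⟨U, hU, hc⟩ := hw
      have hSb : S ∈ s.cachers b := Scheme.mem_cachers.2 hb
      rcases hc with hc | ⟨V, hVU, hV, hh⟩
      · simp [hc] at hSb
      · rw [hV, Finset.mem_singleton] at hSb
        subst hSb
        obtain ⟨h1, h2⟩ := hh.resolve_left fun hh => hS hh rfl
        exact Or.inr ⟨U, hsub U h1, hU, h2⟩
    · exact Or.inl hw

open scoped Classical in
/-- The number of relays `h` for which `b` is recovered by the users not connected to `h`. -/
noncomputable def Scheme.multiplicity (s : Scheme H r N B) (d : Demand H r N)
    (b : Fin N × Fin B) : ℕ :=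
  (Finset.univ.filter fun h => b ∉ s.hiddenBits d h).card

open scoped Classical in
/-- The total cost of the bit `b` in the bound that combines all sets of `H - 1` relays. -/
noncomputable def Scheme.cost (s : Scheme H r N B) (d : Demand H r N) (ρ : User H r → ℕ)
    (b : Fin N × Fin B) : ℕ :=
  (Finset.univ.filter fun h => b ∉ s.withheldBits d ρ h).card +
    ((Finset.range (H - 1)).filter fun j => b ∉ s.acyclicBits d ρ ∧ s.multiplicity d b ≤ j).card +
    if s.multiplicity d b < H then 1 else 0

-- The message to a relay is absent from exactly one of the H conditioning sets, so each of the
-- first H - 1 level sets contains all messages, and the acyclic bound applies there. The top level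
-- contains no message: there the bits of multiplicity below H are charged one each.
open scoped Classical in
lemma sum_ent_hiddenBits_le (hH : 1 ≤ H) (ρ : User H r → ℕ) :
    ∑ h, s.ent d (varSet {h}ᶜ (s.hiddenBits d h)ᶜ) ≤
      (∑ b, (s.cost d ρ b - (Finset.univ.filter fun h => b ∉ s.withheldBits d ρ h).card : ℝ)) *
        Real.log 2 := by
  classical
  set σ : Fin H → Set (Fin H ⊕ (Fin N × Fin B)) :=
    fun h => varSet {h}ᶜ (s.hiddenBits d h)ᶜ with hσ
  have hlev := sum_le_sum_levelSet (s.ent d) (condEntropy_submodular _ _) σ Finset.univ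
  rw [Finset.card_univ, Fintype.card_fin] at hlev
  obtain ⟨n, rfl⟩ : ∃ n, H = n + 1 := ⟨H - 1, by omega⟩
  rw [Finset.sum_range_succ] at hlev
  have hanti : ∀ {x y : Set (Fin (n + 1) ⊕ (Fin N × Fin B))}, x ⊆ y → s.ent d y ≤ s.ent d x :=
    fun hxy => condEntropy_le_of_fiber_subset fun ω _ => fiber_anti hxy
  have hbit : ∀ b : Fin N × Fin B, (Finset.univ.filter fun h => Sum.inr b ∈ σ h).card =
      s.multiplicity d b := fun b => by
    unfold Scheme.multiplicity
    congr 1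
    ext h
    simp [hσ]
  have h1 : ∀ j ∈ Finset.range n, s.ent d (levelSet σ Finset.univ (j + 1)) ≤
      (∑ b, if b ∉ s.acyclicBits d ρ ∧ s.multiplicity d b ≤ j then (1 : ℝ) else 0) *
        Real.log 2 := by
    intro j hj
    rw [Finset.mem_range] at hj
    have hsub : varSet Set.univ {b | j + 1 ≤ s.multiplicity d b} ⊆
        levelSet σ Finset.univ (j + 1) := by
      rintro (h | b) hx
      · change j + 1 ≤ _
        have : (Finset.univ.filter fun h' => Sum.inl h ∈ σ h') = Finset.univ.erase h := by
          ext h'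
          simp [hσ, eq_comm]
        rw [this, Finset.card_erase_of_mem (Finset.mem_univ _), Finset.card_univ,
          Fintype.card_fin]
        omega
      · change j + 1 ≤ _
        rw [hbit]
        exact hx
    refine (hanti hsub).trans ((ent_le_card_bits ρ _).trans (le_of_eq ?_))
    rw [Finset.sum_boole]
    simp
  have h2 : s.ent d (levelSet σ Finset.univ (n + 1)) ≤
      (∑ b, if s.multiplicity d b < n + 1 then (1 : ℝ) else 0) * Real.log 2 := by
    have hsub : varSet ∅ {b | n + 1 ≤ s.multiplicity d b} ⊆ levelSet σ Finset.univ (n + 1) := by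
      rintro (h | b) hx
      · exact hx.elim
      · change n + 1 ≤ _
        rw [hbit]
        exact hx
    refine (hanti hsub).trans ((ent_le_add_bits ∅ _
      (Finset.univ.filter fun b => s.multiplicity d b < n + 1)).trans ?_)
    rw [Finset.sum_boole]
    refine add_le_of_nonpos_left (condEntropy_nonpos_of_determined fun F _ F' _ hv => ?_)
    funext i
    funext j
    refine var_inr_inj.1 (hv (Sum.inr (i, j)) ?_)
    by_cases h : s.multiplicity d (i, j) < n + 1
    · exact Or.inr (by simpa using h)
    · exact Or.inl (not_lt.1 h)
  refine hlev.trans ((add_le_add (Finset.sum_le_sum h1) h2).trans (le_of_eq ?_))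
  rw [← Finset.sum_mul, ← add_mul, Finset.sum_comm, ← Finset.sum_add_distrib]
  congr 1
  refine Finset.sum_congr rfl fun b _ => ?_
  rw [Finset.sum_boole, Scheme.cost]
  push_cast
  ring

/-- The bound that combines the messages to all sets of `H - 1` relays. -/
lemma omit_one_relay_bound (hH : 1 ≤ H) (hG : (s.goodLibraries d).Nonempty)
    (ρ : User H r → ℕ) :
    H * Real.log (s.goodLibraries d).card ≤
      ((H - 1) * (∑ h, s.serverBits d h : ℕ) + ∑ b, (s.cost d ρ b : ℝ)) * Real.log 2 := by
  classical
  have h1 : ∀ h, Real.log (s.goodLibraries d).card ≤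
      s.ent d (varSet {h}ᶜ (s.hiddenBits d h)ᶜ) +
      ((∑ h, s.serverBits d h : ℕ) - s.serverBits d h +
        ∑ b, if b ∉ s.withheldBits d ρ h then (1 : ℝ) else 0) * Real.log 2 := by
    intro h
    have := log_card_goodLibraries_le hG {h}ᶜ
      (Finset.univ.filter fun b => b ∉ s.withheldBits d ρ h)
    have e1 : (↑({h}ᶜ : Finset (Fin H)) : Set (Fin H)) = {h}ᶜ := by simp
    have e2 : (↑(Finset.univ.filter fun b => b ∉ s.withheldBits d ρ h) : Set (Fin N × Fin B)) =
        (s.withheldBits d ρ h)ᶜ := by ext; simp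
    rw [e1, e2] at this
    have e3 : (∑ h, s.serverBits d h) =
        (∑ h' ∈ ({h}ᶜ : Finset (Fin H)), s.serverBits d h') + s.serverBits d h := by
      rw [← Finset.sum_compl_add_sum {h}, Finset.sum_singleton]
    rw [Finset.sum_boole, e3, Nat.cast_add, add_sub_cancel_right]
    exact this.trans (add_le_add_left (ent_withheldBits_le ρ h) _)
  have h2 := Finset.sum_le_sum fun h (_ : h ∈ (Finset.univ : Finset (Fin H))) => h1 h
  have h3 := sum_ent_hiddenBits_le (s := s) (d := d) hH ρ
  rw [Finset.sum_const, Finset.card_univ, Fintype.card_fin, nsmul_eq_mul,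
    Finset.sum_add_distrib, ← Finset.sum_mul, Finset.sum_add_distrib, Finset.sum_comm,
    Finset.sum_sub_distrib, Finset.sum_const, Finset.card_univ, Fintype.card_fin,
    nsmul_eq_mul] at h2
  simp only [Finset.sum_boole] at h2
  rw [Finset.sum_sub_distrib] at h3
  push_cast at h2 h3 ⊢
  linarith

end Converse

end CombinationNetwork

/-! ### Bit weights, averaging over demands, and the lower bounds -/

namespace CombinationNetwork

lemma card_user (H r : ℕ) : Fintype.card (User H r) = H.choose r := by
  rw [Fintype.card_finset_len, Fintype.card_fin]

section Converse

variable {H r N B : ℕ} {s : Scheme H r N B} {d : Demand H r N}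

/-- The weight of the bit `b` for the user `U` that demands its file: `α` if `b` is not cached, and
`ω U V` if it is cached only by the user `V ≠ U`. -/
noncomputable def Scheme.bitWeight (s : Scheme H r N B) (α : ℝ) (ω : User H r → User H r → ℝ)
    (b : Fin N × Fin B) (U : User H r) : ℝ :=
  (if s.cachers b = ∅ then α else 0) +
    ∑ V, if V ≠ U ∧ s.cachers b = {V} then ω U V else 0

lemma bitWeight_of_empty {α : ℝ} {ω : User H r → User H r → ℝ} {b : Fin N × Fin B}
    {U : User H r} (h : s.cachers b = ∅) : s.bitWeight α ω b U = α := by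
  simp [Scheme.bitWeight, h, eq_comm]

lemma bitWeight_of_singleton {α : ℝ} {ω : User H r → User H r → ℝ} {b : Fin N × Fin B}
    {U V : User H r} (h : s.cachers b = {V}) :
    s.bitWeight α ω b U = if V ≠ U then ω U V else 0 := by
  simp only [Scheme.bitWeight, h, Finset.singleton_ne_empty, if_false, zero_add,
    Finset.singleton_inj]
  rw [Finset.sum_eq_single V (fun x _ hx => if_neg fun h => hx h.2.symm) (by simp)]
  simp

lemma bitWeight_of_two_le {α : ℝ} {ω : User H r → User H r → ℝ} {b : Fin N × Fin B}
    {U : User H r} (h : 2 ≤ (s.cachers b).card) : s.bitWeight α ω b U = 0 := by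
  have h1 : s.cachers b ≠ ∅ := fun h1 => by simp [h1] at h
  have h2 : ∀ V, s.cachers b ≠ {V} := fun V h1 => by simp [h1] at h
  simp [Scheme.bitWeight, h1, h2]

lemma cachers_cases (s : Scheme H r N B) (b : Fin N × Fin B) :
    s.cachers b = ∅ ∨ (∃ V, s.cachers b = {V}) ∨ 2 ≤ (s.cachers b).card := by
  rcases Nat.lt_or_ge (s.cachers b).card 2 with h | h
  · interval_cases h' : (s.cachers b).card
    · exact Or.inl (Finset.card_eq_zero.1 h')
    · exact Or.inr (Or.inl (Finset.card_eq_one.1 h'))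
  · exact Or.inr (Or.inr h)

lemma sum_cachers_card (s : Scheme H r N B) :
    ∑ b, (s.cachers b).card = ∑ k, (s.cache k).card := by
  have h1 : ∀ b, (s.cachers b).card = ∑ k, if b ∈ s.cache k then 1 else 0 := fun b => by
    rw [Scheme.cachers, Finset.card_filter]
  simp_rw [h1]
  rw [Finset.sum_comm]
  simp

lemma sum_bitWeight_le (hd : Function.Injective d) {α : ℝ} {ω : User H r → User H r → ℝ}
    {f : Fin N × Fin B → ℝ} (hf : ∀ b, 0 ≤ f b)
    (hw : ∀ U b, d U = b.1 → s.bitWeight α ω b U ≤ f b) :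
    ∑ U, ∑ j, s.bitWeight α ω (d U, j) U ≤ ∑ b, f b := by
  rw [Fintype.sum_prod_type]
  calc ∑ U, ∑ j, s.bitWeight α ω (d U, j) U
      ≤ ∑ U, ∑ j, f (d U, j) :=
        Finset.sum_le_sum fun U _ => Finset.sum_le_sum fun j _ => hw U (d U, j) rfl
    _ = ∑ i ∈ Finset.univ.map ⟨d, hd⟩, ∑ j, f (i, j) := by
        rw [Finset.sum_map]
        rfl
    _ ≤ ∑ i, ∑ j, f (i, j) := Finset.sum_le_sum_of_subset_of_nonneg (Finset.subset_univ _)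
        fun i _ _ => Finset.sum_nonneg fun j _ => hf _

/-- Averaging over the cyclic shifts of a vector of distinct demands. -/
lemma load_bound_of_distinct_demands {α w L M : ℝ} {ω : User H r → User H r → ℝ}
    (hN1 : 1 ≤ N) (hN : Fintype.card (User H r) ≤ N) (hs : s.FitsMemory M) (hα : 0 ≤ α)
    (hω : ∀ V, ∑ U, (if V ≠ U then ω U V else 0) = w)
    (hw : 2 * w ≤ α * Fintype.card (User H r))
    (hd : ∀ d : Demand H r N, Function.Injective d →
      ∑ U, ∑ j, s.bitWeight α ω (d U, j) U ≤ L) :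
    (α * Fintype.card (User H r) - (α * Fintype.card (User H r) - w) *
      (Fintype.card (User H r) * M / N)) * B ≤ L := by
  set K : ℝ := ((Fintype.card (User H r) : ℕ) : ℝ) with hK
  have hK0 : 0 ≤ K := Nat.cast_nonneg _
  have hN0 : (0 : ℝ) < N := by exact_mod_cast hN1
  have : NeZero N := ⟨by omega⟩
  obtain ⟨e⟩ : Nonempty (User H r ↪ Fin N) :=
    Function.Embedding.nonempty_of_card_le (by simpa using hN)
  have h1 : ∑ c : Fin N, ∑ U, ∑ j, s.bitWeight α ω (e U + c, j) U ≤ ∑ _c : Fin N, L :=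
    Finset.sum_le_sum fun c _ => hd (fun U => e U + c) fun U V h => e.injective (by simpa using h)
  -- As the shift `c` varies, every user demands every file exactly once.
  have h2 : ∑ c : Fin N, ∑ U, ∑ j, s.bitWeight α ω (e U + c, j) U =
      ∑ b, ∑ U, s.bitWeight α ω b U := by
    rw [Finset.sum_comm, Finset.sum_comm (γ := Fin N × Fin B)]
    refine Finset.sum_congr rfl fun U _ => ?_
    rw [Fintype.sum_prod_type]
    exact Equiv.sum_comp (Equiv.addLeft (e U)) fun i => ∑ j, s.bitWeight α ω (i, j) U
  have hpt : ∀ b, α * K - (α * K - w) * (s.cachers b).card ≤ ∑ U, s.bitWeight α ω b U := by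
    intro b
    rcases cachers_cases s b with h | ⟨V, h⟩ | h
    · simp only [bitWeight_of_empty h, h]
      simp [hK, mul_comm]
    · simp only [bitWeight_of_singleton h, hω V, h]
      simp
    · simp only [bitWeight_of_two_le h, Finset.sum_const_zero]
      -- Bits cached at least twice have weight zero; by `hw` the affine function of the number of
      -- cachers is already nonpositive at 2.
      have h3 : (2 : ℝ) ≤ (s.cachers b).card := by exact_mod_cast h
      have h4 : 0 ≤ α * K := mul_nonneg hα hK0
      nlinarith
  have h3 := Finset.sum_le_sum fun b (_ : b ∈ (Finset.univ : Finset (Fin N × Fin B))) => hpt b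
  have h4 : ∑ b, ((s.cachers b).card : ℝ) ≤ K * (M * B) := by
    have : ∑ k, ((s.cache k).card : ℝ) ≤ ∑ _k : User H r, M * B :=
      Finset.sum_le_sum fun k _ => hs k
    rw [← Nat.cast_sum, sum_cachers_card, Nat.cast_sum]
    simpa [hK] using this
  rw [Finset.sum_sub_distrib, ← Finset.mul_sum (a := α * K - w), Finset.sum_const,
    Finset.card_univ, Fintype.card_prod, Fintype.card_fin,
    Fintype.card_fin, nsmul_eq_mul, Nat.cast_mul] at h3
  rw [h2, Finset.sum_const, Finset.card_univ, Fintype.card_fin, nsmul_eq_mul] at h1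
  have h5 : 0 ≤ α * K - w := by nlinarith [mul_nonneg hα hK0]
  have h6 := mul_le_mul_of_nonneg_left h4 h5
  refine le_of_mul_le_mul_left ?_ hN0
  have : (N : ℝ) * ((α * K - (α * K - w) * (K * M / N)) * B) =
      N * B * (α * K) - (α * K - w) * (K * (M * B)) := by
    field_simp
  rw [this]
  linarith

/-- A union bound over the users: at error probability `ε` per user at least a fraction 2^(-η) of
the libraries is good. This replaces Fano's inequality, and `ε` does not depend on `N` or `B`. -/
lemma exists_error_bound (hrH : r ≤ H) {η : ℝ} (hη : 0 < η) :
    ∃ ε : ℝ, 0 < ε ∧ ∀ (N B : ℕ) (s : Scheme H r N B) (d : Demand H r N),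
      (∀ k, s.errorProb d k ≤ ε) → (s.goodLibraries d).Nonempty ∧
        (N * B - η) * Real.log 2 ≤ Real.log (s.goodLibraries d).card := by
  classical
  have hK : 0 < Fintype.card (User H r) := by
    rw [card_user]
    exact Nat.choose_pos hrH
  have hK' : (0 : ℝ) < Fintype.card (User H r) := by exact_mod_cast hK
  have hlog2 := Real.log_pos one_lt_two
  have hx : Real.exp (-(η * Real.log 2)) < 1 := Real.exp_lt_one_iff.2 (by nlinarith)
  refine ⟨(1 - Real.exp (-(η * Real.log 2))) / Fintype.card (User H r),
    div_pos (by linarith) hK', fun N B s d herr => ?_⟩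
  set T : ℝ := ((Fintype.card (Library N B) : ℕ) : ℝ) with hT
  have hTeq : T = 2 ^ (N * B) := by
    simp only [hT, Library, Fintype.card_pi, Fintype.card_bool, Finset.prod_const,
      Finset.card_univ, Fintype.card_fin]
    push_cast
    rw [← pow_mul, mul_comm]
  have hT0 : 0 < T := by rw [hTeq]; positivity
  have hbad : ((s.goodLibraries d)ᶜ.card : ℝ) ≤ (1 - Real.exp (-(η * Real.log 2))) * T := by
    have hsub : (s.goodLibraries d)ᶜ ⊆ Finset.univ.biUnion fun k =>
        Finset.univ.filter fun F : Library N B => s.estimate d k F ≠ F (d k) := by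
      intro F hF
      rw [Finset.mem_compl, mem_goodLibraries] at hF
      push Not at hF
      simpa using hF
    have h1 : ((s.goodLibraries d)ᶜ.card : ℝ) ≤ ∑ k, ((Finset.univ.filter
        fun F : Library N B => s.estimate d k F ≠ F (d k)).card : ℝ) := by
      exact_mod_cast (Finset.card_le_card hsub).trans Finset.card_biUnion_le
    refine h1.trans ((Finset.sum_le_card_nsmul _ _ ((1 - Real.exp (-(η * Real.log 2))) /
      Fintype.card (User H r) * T) fun k _ => ?_).trans (le_of_eq ?_))
    · have := herr k
      rw [Scheme.errorProb, div_le_iff₀ hT0] at this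
      exact this
    · rw [nsmul_eq_mul, Finset.card_univ]
      field_simp
  have hgood : Real.exp (-(η * Real.log 2)) * T ≤ (s.goodLibraries d).card := by
    have : ((s.goodLibraries d).card : ℝ) + (s.goodLibraries d)ᶜ.card = T := by
      rw [hT, ← Finset.card_add_card_compl (s.goodLibraries d), Nat.cast_add]
    linarith
  have hpos : 0 < Real.exp (-(η * Real.log 2)) * T := by positivity
  refine ⟨Finset.card_pos.1 (by exact_mod_cast hpos.trans_le hgood), ?_⟩
  have := Real.log_le_log hpos hgood
  rw [Real.log_mul (Real.exp_pos _).ne' hT0.ne', Real.log_exp, hTeq, Real.log_pow] at this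
  push_cast at this
  linarith

lemma mem_acyclicBits (hd : Function.Injective d) {ρ : User H r → ℕ} {b : Fin N × Fin B}
    {U : User H r} (hU : d U = b.1) : b ∈ s.acyclicBits d ρ ↔
      s.cachers b = ∅ ∨ ∃ V, s.cachers b = {V} ∧ ρ U < ρ V := by
  constructor
  · rintro ⟨U', hU', h⟩
    rwa [hd (hU.trans hU'.symm)]
  · exact fun h => ⟨U, hU, h⟩

lemma mem_withheldBits (hd : Function.Injective d) {ρ : User H r → ℕ} {b : Fin N × Fin B}
    {U : User H r} (hU : d U = b.1) {h : Fin H} : b ∈ s.withheldBits d ρ h ↔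
      s.cachers b = ∅ ∨
        ∃ V, V ≠ U ∧ s.cachers b = {V} ∧ (h ∈ V.1 ∨ (h ∉ U.1 ∧ ρ U < ρ V)) := by
  constructor
  · rintro ⟨U', hU', h⟩
    rwa [hd (hU.trans hU'.symm)]
  · exact fun h => ⟨U, hU, h⟩

lemma mem_hiddenBits (hd : Function.Injective d) {b : Fin N × Fin B}
    {U : User H r} (hU : d U = b.1) {h : Fin H} : b ∈ s.hiddenBits d h ↔
      h ∈ U.1 ∧ (s.cachers b = ∅ ∨ ∃ V, V ≠ U ∧ s.cachers b = {V} ∧ h ∈ V.1) := by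
  constructor
  · rintro ⟨U', hU', h⟩
    rwa [hd (hU.trans hU'.symm)]
  · exact fun h => ⟨U, hU, h⟩

lemma cost_of_empty (hH : H = 2 * r) (hr : 1 ≤ r) (hd : Function.Injective d)
    {ρ : User H r → ℕ} {b : Fin N × Fin B} {U : User H r} (hU : d U = b.1)
    (h : s.cachers b = ∅) : s.cost d ρ b = 1 := by
  classical
  have hm : s.multiplicity d b < H := by
    simp only [Scheme.multiplicity, mem_hiddenBits hd hU, h, true_or, and_true,
      Finset.filter_notMem_eq_sdiff]
    rw [Finset.card_sdiff_of_subset (Finset.subset_univ _), Finset.card_univ, Fintype.card_fin,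
      U.2]
    omega
  simp [Scheme.cost, mem_withheldBits hd hU, mem_acyclicBits hd hU, h, hm]

/-- If `U` precedes `V`, only the relays in `U \ V` fail to withhold the bit and the acyclic bound
is free. Otherwise all r relays outside `V` fail, and the levels from the multiplicity H - |U ∩ V|
up to H - 2 each charge one. The last term is the charge at the top level. -/
lemma cost_of_singleton (hH : H = 2 * r) (hd : Function.Injective d)
    {ρ : User H r → ℕ} {b : Fin N × Fin B} {U V : User H r} (hU : d U = b.1) (hVU : V ≠ U)
    (h : s.cachers b = {V}) :
    s.cost d ρ b = (if ρ U < ρ V then r - (U.1 ∩ V.1).card else r + ((U.1 ∩ V.1).card - 1)) +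
      if (U.1 ∩ V.1).Nonempty then 1 else 0 := by
  classical
  have hle : (U.1 ∩ V.1).card ≤ r := (Finset.card_le_card Finset.inter_subset_left).trans U.2.le
  have hm : s.multiplicity d b = H - (U.1 ∩ V.1).card := by
    have : (Finset.univ.filter fun i => b ∉ s.hiddenBits d i) = (U.1 ∩ V.1)ᶜ := by
      ext i
      simp only [mem_hiddenBits hd hU, h, Finset.singleton_ne_empty, false_or,
        Finset.singleton_inj, Finset.mem_filter, Finset.mem_univ, true_and, Finset.mem_compl,
        Finset.mem_inter, not_iff_not]
      refine and_congr_right fun _ => ⟨?_, fun hi => ⟨V, hVU, rfl, hi⟩⟩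
      rintro ⟨W, -, rfl, hi⟩
      exact hi
    unfold Scheme.multiplicity
    convert congrArg Finset.card this
    rw [Finset.card_compl, Fintype.card_fin]
  have hac : b ∈ s.acyclicBits d ρ ↔ ρ U < ρ V := by
    simp only [mem_acyclicBits hd hU, h, Finset.singleton_ne_empty, false_or,
      Finset.singleton_inj]
    refine ⟨?_, fun hi => ⟨V, rfl, hi⟩⟩
    rintro ⟨W, rfl, hi⟩
    exact hi
  have hwh : ∀ i, b ∈ s.withheldBits d ρ i ↔ (i ∈ V.1 ∨ (i ∉ U.1 ∧ ρ U < ρ V)) := by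
    intro i
    simp only [mem_withheldBits hd hU, h, Finset.singleton_ne_empty, false_or,
      Finset.singleton_inj]
    refine ⟨?_, fun hi => ⟨V, hVU, rfl, hi⟩⟩
    rintro ⟨W, -, rfl, hi⟩
    exact hi
  have hne : (U.1 ∩ V.1).Nonempty ↔ s.multiplicity d b < H := by
    rw [hm, ← Finset.card_pos]
    omega
  simp only [hne, Scheme.cost]
  congr 1
  by_cases hlt : ρ U < ρ V
  · have : (Finset.univ.filter fun i => b ∉ s.withheldBits d ρ i) = U.1 \ V.1 := by
      ext i
      simp only [hwh, hlt, and_true, Finset.mem_filter, Finset.mem_univ, true_and,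
        Finset.mem_sdiff]
      tauto
    rw [if_pos hlt, this, Finset.card_sdiff, U.2, Finset.inter_comm]
    simp [hac, hlt]
  · have : (Finset.univ.filter fun i => b ∉ s.withheldBits d ρ i) = V.1ᶜ := by
      ext i
      simp [hwh, hlt]
    rw [if_neg hlt, this, Finset.card_compl, Fintype.card_fin, V.2, hm]
    have h2 : ((Finset.range (H - 1)).filter fun j =>
        b ∉ s.acyclicBits d ρ ∧ H - (U.1 ∩ V.1).card ≤ j) =
        Finset.Ico (H - (U.1 ∩ V.1).card) (H - 1) := by
      ext j
      simp only [hac, hlt, not_false_eq_true, true_and, Finset.mem_filter, Finset.mem_range,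
        Finset.mem_Ico]
      tauto
    rw [h2, Nat.card_Ico]
    omega

lemma cost_of_not_demanded {ρ : User H r → ℕ} {b : Fin N × Fin B} (h : ∀ U, d U ≠ b.1) :
    s.cost d ρ b = H := by
  classical
  have h1 : ∀ i, b ∉ s.hiddenBits d i := fun i ⟨U, hU, _⟩ => h U hU
  have h2 : ∀ i, b ∉ s.withheldBits d ρ i := fun i ⟨U, hU, _⟩ => h U hU
  have h3 : s.multiplicity d b = H := by simp [Scheme.multiplicity, h1]
  have h4 : ∀ j ∈ Finset.range (H - 1), ¬ (b ∉ s.acyclicBits d ρ ∧ H ≤ j) := fun j hj => by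
    rw [Finset.mem_range] at hj
    omega
  rw [Scheme.cost, h3, Finset.filter_false_of_mem h4]
  simp [h2]

lemma cost_of_free (hd : Function.Injective d) {ρ : User H r → ℕ} {b : Fin N × Fin B}
    {U : User H r} (hU : d U = b.1) (h0 : s.cachers b ≠ ∅)
    (h1 : ∀ V, V ≠ U → s.cachers b ≠ {V}) : s.cost d ρ b = H := by
  classical
  have e1 : ∀ i, b ∉ s.hiddenBits d i := fun i hi => by
    obtain ⟨-, h | ⟨V, hV, h, -⟩⟩ := (mem_hiddenBits hd hU).1 hi
    exacts [h0 h, h1 V hV h]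
  have e2 : ∀ i, b ∉ s.withheldBits d ρ i := fun i hi => by
    obtain h | ⟨V, hV, h, -⟩ := (mem_withheldBits hd hU).1 hi
    exacts [h0 h, h1 V hV h]
  have h3 : s.multiplicity d b = H := by simp [Scheme.multiplicity, e1]
  have h4 : ∀ j ∈ Finset.range (H - 1), ¬ (b ∉ s.acyclicBits d ρ ∧ H ≤ j) := fun j hj => by
    rw [Finset.mem_range] at hj
    omega
  rw [Scheme.cost, h3, Finset.filter_false_of_mem h4]
  simp [e2]

/-- An enumeration and its reverse already symmetrize every pair, so no average over all orders is
needed. -/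
lemma exists_opposite_orders (X : Type*) [Fintype X] :
    ∃ ρ ρ' : X → ℕ, ∀ x y, x ≠ y → (ρ x < ρ y ∧ ¬ ρ' x < ρ' y) ∨ (¬ ρ x < ρ y ∧ ρ' x < ρ' y) := by
  refine ⟨fun x => Fintype.equivFin X x, fun x => Fintype.card X - Fintype.equivFin X x,
    fun x y hxy => ?_⟩
  have h : (Fintype.equivFin X x : ℕ) ≠ Fintype.equivFin X y := fun h =>
    hxy ((Fintype.equivFin X).injective (Fin.ext h))
  have h1 := (Fintype.equivFin X x).2
  have h2 := (Fintype.equivFin X y).2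
  simp only
  omega

/-- The bound from the messages to all the relays, for distinct demands. -/
lemma sum_bitWeight_le_all_relays (hd : Function.Injective d) {η : ℝ}
    (hG : (s.goodLibraries d).Nonempty)
    (hη : (N * B - η) * Real.log 2 ≤ Real.log (s.goodLibraries d).card) :
    ∑ U, ∑ j, s.bitWeight 2 (fun _ _ => 1) (d U, j) U ≤
      2 * (∑ h, s.serverBits d h : ℕ) + 2 * η := by
  classical
  obtain ⟨ρ, ρ', hρ⟩ := exists_opposite_orders (User H r)
  have hlog2 := Real.log_pos one_lt_two
  have key : ∀ ρ : User H r → ℕ, ∑ b, (if b ∈ s.acyclicBits d ρ then (1 : ℝ) else 0) ≤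
      (∑ h, s.serverBits d h : ℕ) + η := by
    intro ρ
    have h1 := le_of_mul_le_mul_right (hη.trans (acyclic_bound hG ρ)) hlog2
    have h2 : ((Finset.univ.filter fun b => b ∉ s.acyclicBits d ρ).card : ℝ) =
        N * B - ∑ b, (if b ∈ s.acyclicBits d ρ then (1 : ℝ) else 0) := by
      have := Finset.card_filter_add_card_filter_not (s := (Finset.univ : Finset (Fin N × Fin B)))
        (fun b => b ∈ s.acyclicBits d ρ)
      rw [Finset.card_univ, Fintype.card_prod, Fintype.card_fin, Fintype.card_fin] at this
      rw [Finset.sum_boole, eq_sub_iff_add_eq, add_comm]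
      exact_mod_cast this
    rw [h2] at h1
    linarith
  refine (sum_bitWeight_le (f := fun b => (if b ∈ s.acyclicBits d ρ then (1 : ℝ) else 0) +
    if b ∈ s.acyclicBits d ρ' then (1 : ℝ) else 0) hd (fun b => by positivity)
    fun U b hU => ?_).trans ?_
  · rcases cachers_cases s b with h | ⟨V, h⟩ | h
    · rw [bitWeight_of_empty h, if_pos ((mem_acyclicBits hd hU).2 (Or.inl h)),
        if_pos ((mem_acyclicBits hd hU).2 (Or.inl h))]
      norm_num
    · rw [bitWeight_of_singleton h]
      by_cases hVU : V = U
      · rw [if_neg (not_not.2 hVU)]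
        positivity
      · rw [if_pos hVU]
        rcases hρ U V (Ne.symm hVU) with ⟨h1, -⟩ | ⟨-, h1⟩
        · rw [if_pos ((mem_acyclicBits hd hU).2 (Or.inr ⟨V, h, h1⟩))]
          split_ifs <;> norm_num
        · rw [if_pos (c := b ∈ s.acyclicBits d ρ')
            ((mem_acyclicBits hd hU).2 (Or.inr ⟨V, h, h1⟩))]
          split_ifs <;> norm_num
    · rw [bitWeight_of_two_le h]
      positivity
  · rw [Finset.sum_add_distrib]
    linarith [key ρ, key ρ']

/-- The bound from the messages to all sets of `H - 1` relays, for distinct demands. -/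
lemma sum_bitWeight_le_omit_one_relay (hH : H = 2 * r) (hr : 1 ≤ r) (hd : Function.Injective d)
    {η : ℝ} (hG : (s.goodLibraries d).Nonempty)
    (hη : (N * B - η) * Real.log 2 ≤ Real.log (s.goodLibraries d).card) :
    ∑ U, ∑ j, s.bitWeight (2 * (H - 1))
      (fun U V => 2 * r - if (U.1 ∩ V.1).Nonempty then 1 else 0) (d U, j) U ≤
      2 * (H - 1) * (∑ h, s.serverBits d h : ℕ) + 2 * H * η := by
  classical
  obtain ⟨ρ, ρ', hρ⟩ := exists_opposite_orders (User H r)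
  have hlog2 := Real.log_pos one_lt_two
  have hH0 : (0 : ℝ) ≤ H := Nat.cast_nonneg _
  have hH1 : (1 : ℝ) ≤ H := by exact_mod_cast (by omega : 1 ≤ H)
  have hHr : (H : ℝ) = 2 * r := by exact_mod_cast hH
  have key : ∀ ρ : User H r → ℕ, ∑ b, ((H : ℝ) - s.cost d ρ b) ≤
      (H - 1) * (∑ h, s.serverBits d h : ℕ) + H * η := by
    intro ρ
    have h1 := (mul_le_mul_of_nonneg_left hη hH0).trans
      (omit_one_relay_bound (by omega) hG ρ)
    rw [← mul_assoc] at h1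
    have h2 := le_of_mul_le_mul_right h1 hlog2
    rw [Finset.sum_sub_distrib, Finset.sum_const, Finset.card_univ, Fintype.card_prod,
      Fintype.card_fin, Fintype.card_fin, nsmul_eq_mul, Nat.cast_mul]
    linarith
  have hcost : ∀ (U V : User H r) (b : Fin N × Fin B), d U = b.1 → V ≠ U → s.cachers b = {V} →
      (s.cost d ρ b + s.cost d ρ' b : ℝ) = 2 * r + if (U.1 ∩ V.1).Nonempty then 1 else 0 := by
    intro U V b hU hVU h
    have hle : (U.1 ∩ V.1).card ≤ r := (Finset.card_le_card Finset.inter_subset_left).trans U.2.le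
    have hpos := Finset.card_pos (s := U.1 ∩ V.1)
    -- With i = |U ∩ V| > 0 the two orders contribute (r - i) + (r + i - 1) + 2. For i = 0 the
    -- truncated `i - 1` is 0 and the sum is 2r. This difference of one distinguishes complementary
    -- users.
    have : s.cost d ρ b + s.cost d ρ' b = 2 * r + if (U.1 ∩ V.1).Nonempty then 1 else 0 := by
      rw [cost_of_singleton hH hd hU hVU h, cost_of_singleton hH hd hU hVU h]
      rcases hρ U V (Ne.symm hVU) with ⟨h1, h2⟩ | ⟨h1, h2⟩ <;>
      · simp only [h1, h2, if_true, if_false]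
        split_ifs with h3
        · have := hpos.2 h3
          omega
        · have : (U.1 ∩ V.1).card = 0 := by
            rw [Finset.not_nonempty_iff_eq_empty.1 h3, Finset.card_empty]
          omega
    exact_mod_cast this
  refine (sum_bitWeight_le (f := fun b => ((H : ℝ) - s.cost d ρ b) + (H - s.cost d ρ' b)) hd
    (fun b => ?_) fun U b hU => ?_).trans ?_
  · by_cases hb : ∃ U, d U = b.1
    · obtain ⟨U, hU⟩ := hb
      by_cases h0 : s.cachers b = ∅
      · rw [cost_of_empty hH hr hd hU h0, cost_of_empty hH hr hd hU h0]
        push_cast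
        linarith
      · by_cases h1 : ∃ V, V ≠ U ∧ s.cachers b = {V}
        · obtain ⟨V, hVU, h⟩ := h1
          have h2 := hcost U V b hU hVU h
          have h3 : (if (U.1 ∩ V.1).Nonempty then (1 : ℝ) else 0) ≤ 1 := by
            split_ifs <;> norm_num
          have h4 : (1 : ℝ) ≤ r := by exact_mod_cast hr
          linarith
        · push Not at h1
          rw [cost_of_free hd hU h0 h1, cost_of_free hd hU h0 h1]
          simp
    · push Not at hb
      rw [cost_of_not_demanded hb, cost_of_not_demanded hb]
      simp
  · rcases cachers_cases s b with h | ⟨V, h⟩ | h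
    · rw [bitWeight_of_empty h, cost_of_empty hH hr hd hU h, cost_of_empty hH hr hd hU h]
      push_cast
      linarith
    · rw [bitWeight_of_singleton h]
      by_cases hVU : V = U
      · have h1 : ∀ W, W ≠ U → s.cachers b ≠ {W} := fun W hW hW' => hW (by
          rw [h, Finset.singleton_inj] at hW'
          rw [← hW', hVU])
        have h0 : s.cachers b ≠ ∅ := by simp [h]
        rw [if_neg (not_not.2 hVU), cost_of_free hd hU h0 h1, cost_of_free hd hU h0 h1]
        simp
      · rw [if_pos hVU]
        linarith [hcost U V b hU hVU h]
    · have h1 : ∀ W, W ≠ U → s.cachers b ≠ {W} := fun W _ hW' => by simp [hW'] at h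
      have h0 : s.cachers b ≠ ∅ := fun h0 => by simp [h0] at h
      rw [bitWeight_of_two_le h, cost_of_free hd hU h0 h1, cost_of_free hd hU h0 h1]
      simp
  · rw [Finset.sum_add_distrib]
    linarith [key ρ, key ρ']

lemma serverBits_sum_le {R : ℝ} (h : s.LoadAtMost R) (d : Demand H r N) :
    ((∑ h, s.serverBits d h : ℕ) : ℝ) ≤ H * (R * B) := by
  rw [Nat.cast_sum]
  refine (Finset.sum_le_card_nsmul _ _ (R * B) fun i _ => (h d i).1).trans (le_of_eq ?_)
  simp

lemma card_disjoint_users (hH : H = 2 * r) (V : User H r) :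
    (Finset.univ.filter fun U : User H r => ¬ (U.1 ∩ V.1).Nonempty).card = 1 := by
  rw [Finset.card_eq_one]
  refine ⟨⟨V.1ᶜ, by rw [Finset.card_compl, Fintype.card_fin, V.2]; omega⟩, ?_⟩
  ext U
  simp only [Finset.mem_filter, Finset.mem_univ, true_and, Finset.mem_singleton,
    Finset.not_nonempty_iff_eq_empty, Subtype.ext_iff]
  rw [← Finset.disjoint_iff_inter_eq_empty, ← Finset.subset_compl_iff_disjoint_right]
  refine ⟨fun h => Finset.eq_of_subset_of_card_le h ?_, fun h => h.le⟩
  rw [Finset.card_compl, Fintype.card_fin, V.2, U.2]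
  omega

theorem lower_bound_of_lt (hr : 1 ≤ r) (hrH : r ≤ H) (hN : H.choose r ≤ N) {M R : ℝ}
    (hR : R ∈ achievableLoads H r N M) :
    ((H.choose r : ℕ) : ℝ) / H - ((H.choose r : ℕ) + 1) / (2 * H) * ((H.choose r : ℕ) * M / N) ≤
      R := by
  have hK : 0 < H.choose r := Nat.choose_pos hrH
  have hH0 : (0 : ℝ) < H := by exact_mod_cast (by omega : 0 < H)
  refine le_of_forall_pos_le_add fun δ hδ => ?_
  -- A loss of `H * δ` bits is at most `H * δ * B` because `B ≥ 1`, so it amounts to raising the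
  -- load by `δ`.
  obtain ⟨ε, hε, herr⟩ := exists_error_bound hrH (mul_pos hH0 hδ)
  obtain ⟨B, hB, s, hmem, hload, he⟩ := hR ε hε
  have hBR : (1 : ℝ) ≤ B := by exact_mod_cast hB
  have h := load_bound_of_distinct_demands (s := s) (M := M) (α := 2) (ω := fun _ _ => 1)
    (w := H.choose r - 1) (L := 2 * (H * (R * B)) + 2 * (H * δ)) (by omega)
    (by rwa [card_user]) hmem two_pos.le (fun V => by
      rw [Finset.sum_boole, Finset.filter_ne, Finset.card_erase_of_mem (Finset.mem_univ _),
        Finset.card_univ, card_user, Nat.cast_sub hK, Nat.cast_one])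
    (by rw [card_user]; linarith) (fun d hd => by
      obtain ⟨hG, hη⟩ := herr N B s d (he d)
      have := sum_bitWeight_le_all_relays hd hG hη
      linarith [serverBits_sum_le hload d])
  rw [card_user] at h
  set K : ℝ := ((H.choose r : ℕ) : ℝ)
  set q := K * M / N
  have h1 : H * δ ≤ H * δ * B := le_mul_of_one_le_right (by positivity) hBR
  have h2 : (2 * K - (2 * K - (K - 1)) * q) ≤ 2 * H * (R + δ) := by
    refine le_of_mul_le_mul_right ?_ (by linarith : (0 : ℝ) < B)
    linarith
  have h3 : K / H - (K + 1) / (2 * H) * q = (2 * K - (2 * K - (K - 1)) * q) / (2 * H) := by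
    field_simp
    ring
  rw [h3, div_le_iff₀ (by positivity)]
  linarith

theorem lower_bound_of_eq (hr : 1 ≤ r) (hH : H = 2 * r) (hN : H.choose r ≤ N) {M R : ℝ}
    (hR : R ∈ achievableLoads H r N M) :
    (((H.choose r : ℕ) : ℝ) * (H - 1) -
      (((H.choose r : ℕ) * H + H - (H.choose r : ℕ)) / 2 - 1) * ((H.choose r : ℕ) * M / N)) /
      (H * (H - 1)) ≤ R := by
  have hK : 0 < H.choose r := Nat.choose_pos (by omega)
  have hH2 : (2 : ℝ) ≤ H := by exact_mod_cast (by omega : 2 ≤ H)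
  have hH1 : (1 : ℝ) < H := by linarith
  have hHr : (H : ℝ) = 2 * r := by exact_mod_cast hH
  refine le_of_forall_pos_le_add fun δ hδ => ?_
  obtain ⟨ε, hε, herr⟩ := exists_error_bound (r := r) (H := H) (by omega)
    (mul_pos (sub_pos.2 hH1) hδ)
  obtain ⟨B, hB, s, hmem, hload, he⟩ := hR ε hε
  have hBR : (1 : ℝ) ≤ B := by exact_mod_cast hB
  have h := load_bound_of_distinct_demands (s := s) (M := M) (α := 2 * (H - 1))
    (ω := fun U V => 2 * r - if (U.1 ∩ V.1).Nonempty then 1 else 0)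
    (w := (H - 1) * (H.choose r - 1) + 1)
    (L := 2 * (H - 1) * (H * (R * B)) + 2 * H * ((H - 1) * δ)) (by omega)
    (by rwa [card_user]) hmem (by linarith) (fun V => by
      -- Weight 2r - 1 for everyone, one more for the single user complementary to `V`, and the term
      -- of `V` itself removed.
      have e1 : ∀ U : User H r, (if V ≠ U then
          (2 * r : ℝ) - (if (U.1 ∩ V.1).Nonempty then 1 else 0) else 0) =
          (2 * r - 1) + (if ¬ (U.1 ∩ V.1).Nonempty then 1 else 0) -
            if V = U then (2 * r - 1 : ℝ) else 0 := by
        intro U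
        by_cases hVU : V = U
        · subst hVU
          have : V.1 ≠ ∅ := by
            rw [← Finset.nonempty_iff_ne_empty, ← Finset.card_pos, V.2]
            omega
          simp [this]
        · by_cases h : (U.1 ∩ V.1).Nonempty <;> simp [hVU, h]
      rw [Finset.sum_congr rfl fun U _ => e1 U, Finset.sum_sub_distrib, Finset.sum_add_distrib,
        Finset.sum_boole, card_disjoint_users hH V, Finset.sum_const, Finset.card_univ,
        card_user, Finset.sum_ite_eq, if_pos (Finset.mem_univ _), nsmul_eq_mul, hHr]
      push_cast
      ring)
    (by rw [card_user]; linarith) (fun d hd => by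
      obtain ⟨hG, hη⟩ := herr N B s d (he d)
      have h1 := sum_bitWeight_le_omit_one_relay hH hr hd hG hη
      have h2 := mul_le_mul_of_nonneg_left (serverBits_sum_le hload d)
        (by linarith : (0 : ℝ) ≤ 2 * (H - 1))
      linarith)
  rw [card_user] at h
  set K : ℝ := ((H.choose r : ℕ) : ℝ)
  set q := K * M / N
  have hH0 : (0 : ℝ) < H - 1 := by linarith
  have h1 : 2 * H * ((H - 1) * δ) ≤ 2 * H * ((H - 1) * δ) * B :=
    le_mul_of_one_le_right (by positivity) hBR
  have h2 : (2 * (H - 1) * K - (2 * (H - 1) * K - ((H - 1) * (K - 1) + 1)) * q) ≤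
      2 * (H - 1) * H * (R + δ) := by
    refine le_of_mul_le_mul_right ?_ (by linarith : (0 : ℝ) < B)
    linarith
  rw [div_le_iff₀ (by positivity)]
  linarith

end Converse

end CombinationNetwork

/-! ### Zero-error codes and operations on them -/

namespace CombinationNetwork

/-- There are an uncoded placement of at most `m` bits per user, for files whose bits are indexed
by `β`, and for each demand vector a message of `l h` bits to each relay `h`, such that every user
can recover its file without error when the relays forward all that they receive. -/
def HasCode (H r N : ℕ) (β : Type) (m : ℕ) (l : Fin H → ℕ) : Prop :=
  ∃ cache : User H r → Finset (Fin N × β), (∀ k, (cache k).card ≤ m) ∧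
    ∀ d : Demand H r N, ∃ X : (h : Fin H) → (Fin N → β → Bool) → (Fin (l h) → Bool),
      ∀ (k : User H r) (F F' : Fin N → β → Bool),
        (∀ b ∈ cache k, F b.1 b.2 = F' b.1 b.2) → (∀ h ∈ k.1, X h F = X h F') → F (d k) = F' (d k)

section Codes

variable {H r N : ℕ} {β β' : Type} {m m' : ℕ} {l l' : Fin H → ℕ}

lemma exists_injective_bits {α : Type*} [Finite α] {n : ℕ} (h : Nat.card α ≤ 2 ^ n) :
    ∃ f : α → (Fin n → Bool), Function.Injective f := by
  have := Fintype.ofFinite α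
  rw [Nat.card_eq_fintype_card] at h
  obtain ⟨f⟩ : Nonempty (α ↪ (Fin n → Bool)) :=
    Function.Embedding.nonempty_of_card_le (by simpa using h)
  exact ⟨f, f.injective⟩

/-- Allows messages in arbitrary finite alphabets, such as tuples over a prime field, to be encoded
in bits afterwards. -/
lemma HasCode.of_messages (cache : User H r → Finset (Fin N × β)) (hc : ∀ k, (cache k).card ≤ m)
    (h : ∀ d : Demand H r N, ∃ (α : Fin H → Type) (_ : ∀ h, Finite (α h))
      (X : (h : Fin H) → (Fin N → β → Bool) → α h), (∀ h, Nat.card (α h) ≤ 2 ^ l h) ∧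
      ∀ (k : User H r) (F F' : Fin N → β → Bool),
        (∀ b ∈ cache k, F b.1 b.2 = F' b.1 b.2) → (∀ h ∈ k.1, X h F = X h F') →
          F (d k) = F' (d k)) :
    HasCode H r N β m l := by
  refine ⟨cache, hc, fun d => ?_⟩
  obtain ⟨α, _, X, hα, hX⟩ := h d
  choose f hf using fun h => exists_injective_bits (hα h)
  exact ⟨fun h F => f h (X h F), fun k F F' h1 h2 => hX k F F' h1 fun h hh => hf h (h2 h hh)⟩

lemma HasCode.equiv (e : β ≃ β') (h : HasCode H r N β m l) : HasCode H r N β' m l := by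
  obtain ⟨cache, hc, hX⟩ := h
  refine ⟨fun k => (cache k).map ((Equiv.refl _).prodCongr e).toEmbedding,
    fun k => by rw [Finset.card_map]; exact hc k, fun d => ?_⟩
  obtain ⟨X, hX⟩ := hX d
  refine ⟨fun h F => X h fun i b => F i (e b), fun k F F' h1 h2 => ?_⟩
  have := hX k (fun i b => F i (e b)) (fun i b => F' i (e b)) (fun b hb =>
    h1 (b.1, e b.2) (Finset.mem_map_of_mem _ hb)) h2
  funext b
  simpa using congrFun this (e.symm b)

lemma HasCode.toFin [Fintype β] {B : ℕ} (h : HasCode H r N β m l) (hB : Fintype.card β = B) :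
    HasCode H r N (Fin B) m l :=
  h.equiv (Fintype.equivFinOfCardEq hB)

lemma HasCode.sum (h : HasCode H r N β m l) (h' : HasCode H r N β' m' l') :
    HasCode H r N (β ⊕ β') (m + m') (l + l') := by
  classical
  obtain ⟨c, hc, hX⟩ := h
  obtain ⟨c', hc', hX'⟩ := h'
  refine HasCode.of_messages (fun k => (c k).image (fun b => (b.1, Sum.inl b.2)) ∪
    (c' k).image (fun b => (b.1, Sum.inr b.2))) (fun k => (Finset.card_union_le _ _).trans
      (add_le_add (Finset.card_image_le.trans (hc k)) (Finset.card_image_le.trans (hc' k))))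
      fun d => ?_
  obtain ⟨X, hX⟩ := hX d
  obtain ⟨X', hX'⟩ := hX' d
  refine ⟨fun h => (Fin (l h) → Bool) × (Fin (l' h) → Bool), fun _ => inferInstance,
    fun h F => (X h fun i b => F i (Sum.inl b), X' h fun i b => F i (Sum.inr b)),
    fun h => by simp [pow_add], fun k F F' h1 h2 => ?_⟩
  have e1 := hX k (fun i b => F i (Sum.inl b)) (fun i b => F' i (Sum.inl b))
    (fun b hb => h1 (b.1, Sum.inl b.2) (Finset.mem_union_left _
      (Finset.mem_image_of_mem (fun b : Fin N × β => (b.1, Sum.inl b.2)) hb)))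
    fun h hh => (Prod.ext_iff.1 (h2 h hh)).1
  have e2 := hX' k (fun i b => F i (Sum.inr b)) (fun i b => F' i (Sum.inr b))
    (fun b hb => h1 (b.1, Sum.inr b.2) (Finset.mem_union_right _
      (Finset.mem_image_of_mem (fun b : Fin N × β' => (b.1, Sum.inr b.2)) hb)))
    fun h hh => (Prod.ext_iff.1 (h2 h hh)).2
  funext b
  rcases b with b | b
  · exact congrFun e1 b
  · exact congrFun e2 b

lemma HasCode.finset_sum {ι : Type*} (s : Finset ι) {B m : ι → ℕ} {l : ι → Fin H → ℕ}
    (h : ∀ i ∈ s, HasCode H r N (Fin (B i)) (m i) (l i)) :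
    HasCode H r N (Fin (∑ i ∈ s, B i)) (∑ i ∈ s, m i) (∑ i ∈ s, l i) := by
  classical
  induction s using Finset.induction_on with
  | empty =>
    refine ⟨fun _ => ∅, fun _ => Finset.card_empty.le, fun d =>
      ⟨fun h _ _ => false, fun k F F' _ _ => ?_⟩⟩
    funext b
    exact absurd b.2 (by simp)
  | insert i s hi ih =>
    rw [Finset.sum_insert hi, Finset.sum_insert hi, Finset.sum_insert hi]
    exact ((h i (Finset.mem_insert_self _ _)).sum
      (ih fun j hj => h j (Finset.mem_insert_of_mem hj))).equiv finSumFinEquiv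

lemma HasCode.nsmul {B : ℕ} (n : ℕ) (h : HasCode H r N (Fin B) m l) :
    HasCode H r N (Fin (n * B)) (n * m) (fun i => n * l i) := by
  have := HasCode.finset_sum (Finset.range n) (fun _ _ => h)
  simp only [Finset.sum_const, Finset.card_range, smul_eq_mul] at this
  exact this

/-- The action of a permutation of the relays on the users. -/
def permUser (σ : Equiv.Perm (Fin H)) : User H r ≃ User H r where
  toFun S := ⟨S.1.map σ.toEmbedding, by rw [Finset.card_map, S.2]⟩
  invFun S := ⟨S.1.map σ.symm.toEmbedding, by rw [Finset.card_map, S.2]⟩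
  left_inv S := Subtype.ext (by ext; simp [Finset.mem_map_equiv])
  right_inv S := Subtype.ext (by ext; simp [Finset.mem_map_equiv])

lemma mem_permUser {σ : Equiv.Perm (Fin H)} {S : User H r} {h : Fin H} :
    h ∈ (permUser σ S).1 ↔ σ.symm h ∈ S.1 := Finset.mem_map_equiv

lemma permUser_mul (σ τ : Equiv.Perm (Fin H)) (S : User H r) :
    permUser (σ * τ) S = permUser σ (permUser τ S) :=
  Subtype.ext (by ext; rw [mem_permUser, mem_permUser, mem_permUser]; rfl)

lemma HasCode.relabel (σ : Equiv.Perm (Fin H)) (h : HasCode H r N β m l) :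
    HasCode H r N β m (l ∘ σ) := by
  obtain ⟨c, hc, hX⟩ := h
  refine ⟨fun k => c (permUser σ k), fun k => hc _, fun d => ?_⟩
  obtain ⟨X, hX⟩ := hX fun k => d ((permUser σ).symm k)
  refine ⟨fun h => X (σ h), fun k F F' h1 h2 => ?_⟩
  have := hX (permUser σ k) F F' h1 fun h hh => by
    obtain ⟨i, rfl⟩ := σ.surjective h
    exact h2 i (by rwa [mem_permUser, Equiv.symm_apply_apply] at hh)
  rwa [Equiv.symm_apply_apply] at this

open Nat in
lemma sum_perm_apply (hH : 1 ≤ H) (l : Fin H → ℕ) (h : Fin H) :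
    ∑ σ : Equiv.Perm (Fin H), l (σ h) = (H - 1)! * ∑ i, l i := by
  have hconst : ∀ i, ∑ σ : Equiv.Perm (Fin H), l (σ i) = ∑ σ : Equiv.Perm (Fin H), l (σ h) := by
    intro i
    rw [← Equiv.sum_comp (Equiv.mulRight (Equiv.swap i h))]
    simp
  have h1 : ∑ i, ∑ σ : Equiv.Perm (Fin H), l (σ i) = H ! * ∑ i, l i := by
    rw [Finset.sum_comm, Finset.sum_congr rfl fun σ _ => Equiv.sum_comp σ l]
    simp [Fintype.card_perm]
  rw [Finset.sum_congr rfl fun i _ => hconst i, Finset.sum_const, Finset.card_univ,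
    Fintype.card_fin, smul_eq_mul, ← Nat.mul_factorial_pred (by omega), mul_assoc] at h1
  exact Nat.eq_of_mul_eq_mul_left hH h1

open Nat in
/-- Averaging a code over all permutations of the relays equalizes the loads of the links. -/
lemma HasCode.symmetrize {B : ℕ} (hH : 1 ≤ H) (h : HasCode H r N (Fin B) m l) :
    HasCode H r N (Fin (H ! * B)) (H ! * m) (fun _ => (H - 1)! * ∑ i, l i) := by
  have := HasCode.finset_sum (Finset.univ : Finset (Equiv.Perm (Fin H)))
    (fun σ _ => h.relabel σ)
  simp only [Finset.sum_const, Finset.card_univ, smul_eq_mul, Fintype.card_perm,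
    Fintype.card_fin] at this
  convert this using 1
  funext i
  rw [Finset.sum_apply, ← sum_perm_apply hH l i]
  rfl

/-- Sending every file uncoded, with empty caches. -/
lemma hasCode_uncached (hr : 1 ≤ r) (N b : ℕ) :
    ∃ l : Fin H → ℕ, ∑ h, l h = H.choose r * b ∧ HasCode H r N (Fin b) 0 l := by
  classical
  have hne : ∀ k : User H r, ∃ h, h ∈ k.1 := fun k => Finset.card_pos.1 (by rw [k.2]; omega)
  choose f hf using hne
  refine ⟨fun h => (Finset.univ.filter fun k => f k = h).card * b, ?_,
    HasCode.of_messages (fun _ => ∅) (fun _ => by simp) fun d =>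
      ⟨fun h => {k // f k = h} → Fin b → Bool, fun _ => inferInstance,
        fun h F k => F (d k.1), fun h => ?_, fun k F F' _ h2 => ?_⟩⟩
  · rw [← Finset.sum_mul, ← Finset.card_eq_sum_card_fiberwise (fun _ _ => Finset.mem_univ _),
      Finset.card_univ, card_user]
  · rw [Nat.card_fun, Nat.card_fun, Nat.card_eq_fintype_card (α := Bool),
      Nat.card_eq_fintype_card (α := Fin b), Nat.card_eq_fintype_card, Fintype.card_bool, Fintype.card_fin,
      Fintype.card_subtype, ← pow_mul, mul_comm]
  · exact congrFun (h2 (f k) (hf k)) ⟨k, rfl⟩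

/-- Every user `S` can recover from the messages of its relays the values `Y S T e` and `Y T S e`
for all the other users `T`. -/
def IsPairCode {E V : Type} {α : Fin H → Type}
    (X : (h : Fin H) → (User H r → User H r → E → V) → α h) : Prop :=
  ∀ (Y Y' : User H r → User H r → E → V) (S : User H r), (∀ h ∈ S.1, X h Y = X h Y') →
    ∀ T, T ≠ S → ∀ e, Y S T e = Y' S T e ∧ Y T S e = Y' T S e

/-- The delivery of pairwise sums, when every bit is cached by exactly one user. -/
lemma hasCode_of_isPairCode {E V : Type} [Fintype E] [AddCommGroup V] {α : Fin H → Type}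
    [∀ h, Finite (α h)] {X : (h : Fin H) → (User H r → User H r → E → V) → α h}
    (hX : IsPairCode X) {b : ℕ} {ι : (Fin b → Bool) → V} (hι : Function.Injective ι)
    (hl : ∀ h, Nat.card (α h) ≤ 2 ^ l h) (N : ℕ) :
    HasCode H r N (User H r × E × Bool × Fin b) (N * (Fintype.card E * (2 * b))) l := by
  classical
  refine HasCode.of_messages (fun k => Finset.univ ×ˢ ({k} ×ˢ Finset.univ)) (fun k => ?_)
    -- The first index in `User H r × E × Bool × Fin b` names the caching user. User `S` knows the
    -- second summand here and gets the `true` half of its piece; from the value for `(T, S)` it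
    -- gets the `false` half.
    fun d => ⟨α, inferInstance, fun h F => X h fun S T e =>
      ι (fun j => F (d S) (T, e, true, j)) + ι (fun j => F (d T) (S, e, false, j)),
      hl, fun S F F' h1 h2 => ?_⟩
  · simp
  · have hc : ∀ i e c j, F i (S, e, c, j) = F' i (S, e, c, j) := fun i e c j =>
      h1 (i, (S, e, c, j)) (by simp)
    have hc' : ∀ i e c, (fun j => F i (S, e, c, j)) = fun j => F' i (S, e, c, j) :=
      fun i e c => funext fun j => hc i e c j
    have h3 := hX _ _ S h2
    funext ⟨T, e, c, j⟩
    by_cases hT : T = S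
    · rw [hT]
      exact hc _ _ _ _
    · obtain ⟨h4, h5⟩ := h3 T hT e
      simp only [hc'] at h4 h5
      cases c
      · exact congrFun (hι (add_left_cancel h5)) j
      · exact congrFun (hι (add_right_cancel h4)) j

/-- The relays forward everything, and a user outputs its file in any library consistent with what
it sees; by the code property all such libraries agree on that file. -/
lemma HasCode.mem_achievableLoads {B : ℕ} (hB : 1 ≤ B) (h : HasCode H r N (Fin B) m l) {M R : ℝ}
    (hm : (m : ℝ) ≤ M * B) (hl : ∀ h, (l h : ℝ) ≤ R * B) : R ∈ achievableLoads H r N M := by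
  classical
  obtain ⟨c, hc, hX⟩ := h
  choose X hX using hX
  let s : Scheme H r N B :=
    { cache := c
      serverBits := fun _ h => l h
      relayBits := fun _ h _ => l h
      serverMsg := X
      relayMsg := fun _ _ _ x => x
      decode := fun d k u x =>
        if h : ∃ F : Library N B, (∀ b : {b // b ∈ c k}, F b.1.1 b.1.2 = u b) ∧
          ∀ h : {h // h ∈ k.1}, X d h.1 F = x h then h.choose (d k) else fun _ => false }
  have hs : ∀ d k F, s.estimate d k F = F (d k) := by
    intro d k F
    have hex : ∃ F' : Library N B, (∀ b : {b // b ∈ c k}, F' b.1.1 b.1.2 = F b.1.1 b.1.2) ∧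
        ∀ h : {h // h ∈ k.1}, X d h.1 F' = X d h.1 F := ⟨F, fun _ => rfl, fun _ => rfl⟩
    have h1 : s.estimate d k F = hex.choose (d k) := dif_pos hex
    rw [h1]
    exact hX d k _ _ (fun b hb => hex.choose_spec.1 ⟨b, hb⟩) fun h hh => hex.choose_spec.2 ⟨h, hh⟩
  refine fun ε hε => ⟨B, hB, s, fun k => (Nat.cast_le.2 (hc k)).trans hm,
    fun d h => ⟨hl h, fun _ _ => hl h⟩, fun d k => ?_⟩
  simp [Scheme.errorProb, hs, hε.le]

end Codes

end CombinationNetwork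

/-! ### Pair codes: common relays and zero-sum vectors -/

namespace CombinationNetwork

section PairCodes

variable {H r : ℕ}

/-- The incidence vector of the relays of a user. -/
def relayIndicator (V : Type*) [Field V] (S : User H r) : Fin H → V :=
  fun h => if h ∈ S.1 then 1 else 0

lemma relayIndicator_injective (V : Type*) [Field V] :
    Function.Injective (relayIndicator V : User H r → Fin H → V) := fun S T h =>
  Subtype.ext (by
    ext i
    have := congrFun h i
    by_cases h1 : i ∈ S.1 <;> by_cases h2 : i ∈ T.1 <;> simp_all [relayIndicator])

lemma relayIndicator_ne_one {V : Type*} [Field V] (hrH : r < H) (S : User H r) :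
    relayIndicator V S ≠ 1 := fun h => by
  have : S.1 = Finset.univ := Finset.eq_univ_of_forall fun i => by
    by_contra hi
    simpa [relayIndicator, hi] using congrFun h i
  have h2 := S.2
  rw [this, Finset.card_univ, Fintype.card_fin] at h2
  omega

lemma apply_eq_sum {V : Type*} [Field V] (f : (Fin H → V) →ₗ[V] V) (v : Fin H → V) :
    f v = ∑ h, v h * f (Pi.single h 1) := by
  rw [LinearMap.pi_apply_eq_sum_univ f v]
  simp only [smul_eq_mul, eq_comm]
  refine Finset.sum_congr rfl fun i _ => ?_
  congr 2
  funext j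
  simp [Pi.single_apply, eq_comm]

lemma apply_relayIndicator {V : Type*} [Field V] (f : (Fin H → V) →ₗ[V] V) (S : User H r) :
    f (relayIndicator V S) = ∑ h ∈ S.1, f (Pi.single h 1) := by
  rw [apply_eq_sum]
  simp [relayIndicator]

/-- A functional vanishing on all indicators takes equal values on all unit vectors, by exchanging
one relay of a user; r times this value is 0, so the functional is zero. -/
lemma span_relayIndicator {V : Type*} [Field V] (hr : 1 ≤ r) (hrH : r < H) (hV : (r : V) ≠ 0) :
    Submodule.span V (Set.range (relayIndicator V : User H r → Fin H → V)) = ⊤ := by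
  classical
  by_contra hne
  obtain ⟨f, hf, hle⟩ := Submodule.exists_le_ker_of_lt_top _ (lt_top_iff_ne_top.2 hne)
  have hS : ∀ S : User H r, ∑ h ∈ S.1, f (Pi.single h 1) = 0 := fun S => by
    rw [← apply_relayIndicator]
    exact hle (Submodule.subset_span ⟨S, rfl⟩)
  have heq : ∀ i j, f (Pi.single i 1) = f (Pi.single j 1) := by
    intro i j
    by_cases hij : i = j
    · rw [hij]
    obtain ⟨A, hA, hAc⟩ := Finset.exists_subset_card_eq (s := ({i, j} : Finset (Fin H))ᶜ)
      (n := r - 1) (by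
        rw [Finset.card_compl, Fintype.card_fin, Finset.card_pair hij]
        omega)
    have hi : i ∉ A := fun h => by simpa using hA h
    have hj : j ∉ A := fun h => by simpa using hA h
    have h1 := hS ⟨insert i A, by rw [Finset.card_insert_of_notMem hi]; omega⟩
    have h2 := hS ⟨insert j A, by rw [Finset.card_insert_of_notMem hj]; omega⟩
    simp only [Finset.sum_insert hi] at h1
    simp only [Finset.sum_insert hj] at h2
    exact add_right_cancel (h1.trans h2.symm)
  refine hf (LinearMap.ext fun v => ?_)
  rw [apply_eq_sum, LinearMap.zero_apply]
  refine Finset.sum_eq_zero fun i _ => ?_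
  obtain ⟨S, -, hSc⟩ := Finset.exists_subset_card_eq (s := (Finset.univ : Finset (Fin H)))
    (n := r) (by simpa using hrH.le)
  have := hS ⟨S, hSc⟩
  rw [Finset.sum_congr rfl fun h _ => heq h i, Finset.sum_const, hSc, nsmul_eq_mul] at this
  rw [(mul_eq_zero.1 this).resolve_left hV, mul_zero]

/-- There are `H - 1` users for whom the sums over their relays of a vector with zero total can be
prescribed at will. -/
lemma exists_prescribed_sums {V : Type*} [Field V] (hr : 1 ≤ r) (hrH : r < H)
    (hV : (r : V) ≠ 0) :
    ∃ J : Finset (User H r), J.card = H - 1 ∧ ∀ C : User H r → V, ∃ x : Fin H → V,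
      ∑ h, x h = 0 ∧ ∀ S ∈ J, ∑ h ∈ S.1, x h = C S := by
  classical
  have h1 : LinearIndepOn V id ({1} : Set (Fin H → V)) :=
    (linearIndepOn_singleton_iff V).2 (fun h => by
      have := congrFun h (⟨0, by omega⟩ : Fin H)
      simp at this)
  -- The all-one vector is completed to a basis by indicators; the H - 1 users so used form `J`.
  obtain ⟨b, hbt, hsb, htb, hb⟩ := exists_linearIndepOn_extension h1
    (Set.singleton_subset_iff.2 (Set.mem_insert 1
      (Set.range (relayIndicator V : User H r → Fin H → V))))
  have hspan : ⊤ ≤ Submodule.span V (Set.range ((↑) : b → Fin H → V)) := by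
    rw [Subtype.range_coe, ← span_relayIndicator hr hrH hV, Submodule.span_le]
    exact fun v hv => by simpa using htb ⟨v, Set.mem_insert_of_mem _ hv, rfl⟩
  let bas : Module.Basis b V (Fin H → V) := Module.Basis.mk hb hspan
  have : Fintype b := FiniteDimensional.fintypeBasisIndex bas
  have hcard : b.ncard = H := by
    rw [← Nat.card_coe_set_eq, Nat.card_eq_fintype_card, ← Module.finrank_eq_card_basis bas]
    simp
  set J : Finset (User H r) := Finset.univ.filter fun S => relayIndicator V S ∈ b with hJ
  have hbJ : b = insert 1 (relayIndicator V '' (J : Set (User H r))) := by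
    ext v
    constructor
    · intro hv
      rcases hbt hv with rfl | ⟨S, rfl⟩
      · exact Set.mem_insert _ _
      · exact Set.mem_insert_of_mem _ ⟨S, by simpa [hJ] using hv, rfl⟩
    · rintro (rfl | ⟨S, hS, rfl⟩)
      · exact hsb rfl
      · simpa [hJ] using hS
  refine ⟨J, ?_, fun C => ?_⟩
  · have hnot : (1 : Fin H → V) ∉ relayIndicator V '' (J : Set (User H r)) := by
      rintro ⟨S, -, hS⟩
      exact relayIndicator_ne_one hrH S hS
    rw [hbJ, Set.ncard_insert_of_notMem hnot (J.finite_toSet.image _),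
      Set.ncard_image_of_injective _ (relayIndicator_injective V), Set.ncard_coe_finset] at hcard
    omega
  -- The sought vector is a functional read on the unit vectors. The default 0 is its value at the
  -- all-one vector, which is the zero-total condition.
  · let f : (Fin H → V) →ₗ[V] V := bas.constr V fun v : b =>
      if h : ∃ S : User H r, relayIndicator V S = v then C h.choose else 0
    have hbas : ∀ v : b, f v = if h : ∃ S : User H r, relayIndicator V S = v
        then C h.choose else 0 := fun v => by
      have := bas.constr_basis V (fun v : b =>
        if h : ∃ S : User H r, relayIndicator V S = v then C h.choose else 0) v
      rwa [show bas v = v from Module.Basis.mk_apply hb hspan v] at this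
    refine ⟨fun h => f (Pi.single h 1), ?_, fun S hS => ?_⟩
    · have h2 := hbas ⟨1, hsb rfl⟩
      rw [dif_neg (by rintro ⟨S, hS⟩; exact relayIndicator_ne_one hrH S hS), apply_eq_sum] at h2
      simpa using h2
    · have h2 := hbas ⟨relayIndicator V S, by simpa [hJ] using hS⟩
      have hex : ∃ T : User H r, relayIndicator V T = relayIndicator V S := ⟨S, rfl⟩
      rw [dif_pos hex, relayIndicator_injective V hex.choose_spec, apply_relayIndicator] at h2
      exact h2

lemma permUser_inv_apply (σ : Equiv.Perm (Fin H)) (S : User H r) :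
    permUser σ⁻¹ (permUser σ S) = S := by
  rw [← permUser_mul, inv_mul_cancel]
  exact Subtype.ext (by ext; rw [mem_permUser]; rfl)

lemma sum_permUser {V : Type*} [AddCommMonoid V] (σ : Equiv.Perm (Fin H)) (S : User H r)
    (f : Fin H → V) : ∑ h ∈ (permUser σ S).1, f (σ.symm h) = ∑ h ∈ S.1, f h := by
  change ∑ h ∈ S.1.map _, _ = _
  simp

lemma exists_permUser_eq (S T : User H r) : ∃ σ : Equiv.Perm (Fin H), permUser σ S = T := by
  classical
  have hc : S.1.card = T.1.card := S.2.trans T.2.symm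
  let e : {x // x ∈ S.1} ≃ {x // x ∈ T.1} := Finset.equivOfCardEq hc
  refine ⟨e.extendSubtype, Subtype.ext (Finset.eq_of_subset_of_card_le ?_ ?_)⟩
  · intro x hx
    obtain ⟨y, hy, rfl⟩ := Finset.mem_map.1 hx
    exact e.extendSubtype_mem y hy
  · rw [T.2, (permUser _ S).2]

-- Orbit-stabilizer for the transitive action of the permutations on the users.
open Nat in
lemma choose_mul_card_stabilizer (S : User H r) :
    H.choose r * Nat.card {σ : Equiv.Perm (Fin H) // permUser σ S = S} = H ! := by
  classical
  choose t ht using exists_permUser_eq S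
  have hinv : ∀ T, permUser (t T)⁻¹ T = S := fun T => by
    have := permUser_inv_apply (t T) S
    rwa [ht] at this
  have e : User H r × {σ : Equiv.Perm (Fin H) // permUser σ S = S} ≃ Equiv.Perm (Fin H) :=
    { toFun := fun p => t p.1 * p.2.1
      invFun := fun σ => (permUser σ S, ⟨(t (permUser σ S))⁻¹ * σ, by
        rw [permUser_mul, hinv]⟩)
      left_inv := fun ⟨T, g⟩ => by
        have : permUser (t T * g.1) S = T := by rw [permUser_mul, g.2, ht]
        simp [this]
      right_inv := fun σ => by simp }
  have := Nat.card_congr e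
  rwa [Nat.card_prod, Nat.card_eq_fintype_card, card_user, Nat.card_eq_fintype_card,
    Nat.card_eq_fintype_card, Fintype.card_perm, Fintype.card_fin,
    ← Nat.card_eq_fintype_card] at this

/-- The ordered pairs of distinct users with a common relay. -/
abbrev MeetingPair (H r : ℕ) : Type :=
  {p : User H r × User H r // p.1 ≠ p.2 ∧ (p.1.1 ∩ p.2.1).Nonempty}

/-- A common relay of two users. -/
noncomputable def commonRelay (p : MeetingPair H r) : Fin H := p.2.2.choose

lemma commonRelay_mem_left (p : MeetingPair H r) : commonRelay p ∈ p.1.1.1 :=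
  Finset.mem_of_mem_inter_left p.2.2.choose_spec

lemma commonRelay_mem_right (p : MeetingPair H r) : commonRelay p ∈ p.1.2.1 :=
  Finset.mem_of_mem_inter_right p.2.2.choose_spec

/-- The relays forward the values of the pairs that are assigned to them. -/
def meetingMsg (E V : Type) (h : Fin H) (Y : User H r → User H r → E → V) :
    {p : MeetingPair H r // commonRelay p = h} × E → V :=
  fun p => Y p.1.1.1.1 p.1.1.1.2 p.2

lemma eq_of_meetingMsg_eq {E V : Type} {Y Y' : User H r → User H r → E → V} {S T : User H r}
    (hne : S ≠ T) (hST : (S.1 ∩ T.1).Nonempty) {U : User H r} (hU : U = S ∨ U = T)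
    (h : ∀ h ∈ U.1, meetingMsg E V h Y = meetingMsg E V h Y') (e : E) : Y S T e = Y' S T e := by
  let p : MeetingPair H r := ⟨(S, T), hne, hST⟩
  have hp : commonRelay p ∈ U.1 := by
    rcases hU with rfl | rfl
    · exact commonRelay_mem_left p
    · exact commonRelay_mem_right p
  exact congrFun (h _ hp) (⟨p, rfl⟩, e)

lemma sum_card_commonRelay : ∑ h : Fin H, Nat.card {p : MeetingPair H r // commonRelay p = h} =
    Nat.card (MeetingPair H r) := by
  classical
  rw [← Nat.card_sigma]
  exact Nat.card_congr (Equiv.sigmaFiberEquiv commonRelay)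

lemma card_meetingPair_of_lt (hH : H < 2 * r) :
    Nat.card (MeetingPair H r) = H.choose r * (H.choose r - 1) := by
  classical
  have hmeet : ∀ S T : User H r, (S.1 ∩ T.1).Nonempty := fun S T => by
    rw [← Finset.not_disjoint_iff_nonempty_inter]
    intro h
    have h1 := Finset.card_le_univ (S.1 ∪ T.1)
    rw [Finset.card_union_of_disjoint h, S.2, T.2, Fintype.card_fin] at h1
    omega
  have e : (Finset.univ.filter fun p : User H r × User H r =>
      p.1 ≠ p.2 ∧ (p.1.1 ∩ p.2.1).Nonempty) = Finset.univ.offDiag := by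
    ext p
    simp [hmeet p.1 p.2]
  rw [Nat.card_eq_fintype_card, Fintype.card_subtype, e, Finset.offDiag_card, Finset.card_univ,
    card_user, Nat.mul_sub_one]

lemma card_meetingPair_of_eq (hr : 1 ≤ r) (hH : H = 2 * r) :
    Nat.card (MeetingPair H r) = H.choose r * (H.choose r - 2) := by
  classical
  rw [Nat.card_eq_fintype_card, Fintype.card_subtype, Finset.card_filter,
    Fintype.sum_prod_type_right]
  simp_rw [← Finset.card_filter]
  rw [Finset.sum_const_nat (m := H.choose r - 2), Finset.card_univ, card_user]
  intro V _
  have h1 := card_disjoint_users hH V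
  have h2 : (Finset.univ.filter fun U : User H r => (U.1 ∩ V.1).Nonempty).card + 1 =
      H.choose r := by
    rw [← h1, Finset.card_filter_add_card_filter_not, Finset.card_univ, card_user]
  have h3 : (Finset.univ.filter fun U : User H r => U ≠ V ∧ (U.1 ∩ V.1).Nonempty) =
      (Finset.univ.filter fun U : User H r => (U.1 ∩ V.1).Nonempty).erase V := by
    ext U
    simp
  rw [h3, Finset.card_erase_of_mem]
  · omega
  · rw [Finset.mem_filter, Finset.inter_self, ← Finset.card_pos, V.2]
    exact ⟨Finset.mem_univ _, hr⟩

/-- Bertrand's postulate: `b` bits embed in a field whose elements need `b + 1` bits, an overhead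
that vanishes for large `b`. As p > r, the span argument applies. -/
lemma exists_prime_field (b : ℕ) (hb : r ≤ b) : ∃ p : ℕ, ∃ _ : Fact p.Prime,
    2 ^ b ≤ p ∧ p ≤ 2 ^ (b + 1) ∧ (1 ≤ r → ((r : ℕ) : ZMod p) ≠ 0) := by
  obtain ⟨p, hp, h1, h2⟩ := Nat.exists_prime_lt_and_le_two_mul (2 ^ b) (by positivity)
  refine ⟨p, ⟨hp⟩, h1.le, by rw [pow_succ]; omega, fun hr h => ?_⟩
  have := Nat.le_of_dvd hr ((ZMod.natCast_eq_zero_iff r p).1 h)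
  have := Nat.lt_two_pow_self (n := b)
  omega

/-- The delivery when each bit is cached by exactly one user and any two users have a common
relay. -/
lemma hasCode_cached_of_lt (hH : H < 2 * r) (N b : ℕ) (hb : r ≤ b) :
    ∃ l : Fin H → ℕ, ∑ h, l h = H.choose r * (H.choose r - 1) * (b + 1) ∧
      HasCode H r N (Fin (H.choose r * 2 * b)) (N * (2 * b)) l := by
  classical
  obtain ⟨p, _, hp1, hp2, -⟩ := exists_prime_field b hb
  obtain ⟨ι⟩ : Nonempty ((Fin b → Bool) ↪ ZMod p) :=
    Function.Embedding.nonempty_of_card_le (by simpa [ZMod.card] using hp1)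
  let X : (h : Fin H) → (User H r → User H r → Unit → ZMod p) →
      ({p : MeetingPair H r // commonRelay p = h} × Unit → ZMod p) := meetingMsg Unit (ZMod p)
  have hX : IsPairCode X := by
    intro Y Y' S h T hT e
    have hmeet : (S.1 ∩ T.1).Nonempty := by
      rw [← Finset.not_disjoint_iff_nonempty_inter]
      intro hd
      have h1 := Finset.card_le_univ (S.1 ∪ T.1)
      rw [Finset.card_union_of_disjoint hd, S.2, T.2, Fintype.card_fin] at h1
      omega
    exact ⟨eq_of_meetingMsg_eq hT.symm hmeet (Or.inl rfl) h e,
      eq_of_meetingMsg_eq hT (by rwa [Finset.inter_comm]) (Or.inr rfl) h e⟩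
  refine ⟨fun h => Nat.card {p : MeetingPair H r // commonRelay p = h} * (b + 1), ?_, ?_⟩
  · rw [← Finset.sum_mul, sum_card_commonRelay, card_meetingPair_of_lt hH]
  · have := (hasCode_of_isPairCode hX ι.injective
      (l := fun h => Nat.card {p : MeetingPair H r // commonRelay p = h} * (b + 1)) (fun h => by
        rw [Nat.card_fun, Nat.card_zmod, Nat.card_prod, Nat.card_unique (α := Unit), mul_one,
          mul_comm, pow_mul]
        exact Nat.pow_le_pow_left hp2 _) N).toFin (B := H.choose r * 2 * b) (by
          simp [mul_assoc])
    simpa using this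

open Nat in
/-- The delivery when each bit is cached by exactly one user and complementary users have no common
relay. -/
lemma hasCode_cached_of_eq (hr : 1 ≤ r) (hH : H = 2 * r) (N b : ℕ) (hb : r ≤ b) :
    ∃ l : Fin H → ℕ, ∑ h, l h =
        (H.choose r * (H.choose r - 2) * ((H - 1) * (r ! * (H - r)!)) + H * H !) * (b + 1) ∧
      HasCode H r N (Fin (H.choose r * (2 * ((H - 1) * (r ! * (H - r)!))) * b))
        (N * (2 * ((H - 1) * (r ! * (H - r)!)) * b)) l := by
  classical
  obtain ⟨p, _, hp1, hp2, hp3⟩ := exists_prime_field b hb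
  obtain ⟨ι⟩ : Nonempty ((Fin b → Bool) ↪ ZMod p) :=
    Function.Embedding.nonempty_of_card_le (by simpa [ZMod.card] using hp1)
  obtain ⟨J, hJ, hsol⟩ := exists_prescribed_sums (V := ZMod p) hr (by omega : r < H) (hp3 hr)
  -- For a fixed user `S`, this set parametrizes the pairs of `j ∈ J` and a permutation taking `j`
  -- to `S`: every user is served equally often when all permutations are used.
  let E : Type := Σ j : {j // j ∈ J}, {σ : Equiv.Perm (Fin H) // permUser σ j.1 = j.1}
  have hE : Fintype.card E = (H - 1) * (r ! * (H - r)!) := by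
    rw [Fintype.card_sigma, Finset.sum_const_nat (m := r ! * (H - r)!), Finset.card_univ,
      Fintype.card_coe, hJ]
    intro j _
    refine Nat.eq_of_mul_eq_mul_left (Nat.choose_pos (by omega : r ≤ H)) ?_
    rw [← Nat.card_eq_fintype_card, choose_mul_card_stabilizer, ← mul_assoc,
      Nat.choose_mul_factorial_mul_factorial (by omega)]
  choose t ht using fun S T : User H r => exists_permUser_eq S T
  let compl : User H r → User H r := fun S =>
    ⟨S.1ᶜ, by rw [Finset.card_compl, Fintype.card_fin, S.2]; omega⟩
  have hinv : ∀ S T, permUser (t S T)⁻¹ T = S := fun S T => by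
    have := permUser_inv_apply (t S T) S
    rwa [ht] at this
  -- The value that the family of `σ` carries at its member `j`.
  let val : (User H r → User H r → E → ZMod p) → Equiv.Perm (Fin H) → User H r → ZMod p :=
    fun Y σ S => if hS : S ∈ J then
      Y (permUser σ S) (compl (permUser σ S)) ⟨⟨S, hS⟩, (t S (permUser σ S))⁻¹ * σ, by
        rw [permUser_mul, hinv]⟩ else 0
  choose x hx0 hx using hsol
  let X : (h : Fin H) → (User H r → User H r → E → ZMod p) →
      ({p : MeetingPair H r // commonRelay p = h} × E → ZMod p) ×
        (Equiv.Perm (Fin H) → ZMod p) :=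
    fun h Y => (meetingMsg E (ZMod p) h Y, fun σ => x (val Y σ) (σ.symm h))
  have hsum : ∀ Y S (e : E), ∑ h ∈ S.1, x (val Y (t e.1.1 S * e.2.1))
      ((t e.1.1 S * e.2.1).symm h) = Y S (compl S) e := by
    rintro Y S ⟨⟨j, hj⟩, g, hg⟩
    simp only at hg ⊢
    have hS : permUser (t j S * g) j = S := by rw [permUser_mul, hg, ht]
    have h1 := hx (val Y (t j S * g)) j hj
    have h2 : ∑ h ∈ S.1, x (val Y (t j S * g)) ((t j S * g).symm h) =
        ∑ h ∈ j.1, x (val Y (t j S * g)) h := by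
      have := sum_permUser (t j S * g) j (x (val Y (t j S * g)))
      rwa [hS] at this
    rw [h2, h1]
    simp only [val, dif_pos hj, hS]
    congr 3
    simp
  have htot : ∀ Y (σ : Equiv.Perm (Fin H)), ∑ h, x (val Y σ) (σ.symm h) = 0 := fun Y σ => by
    rw [Equiv.sum_comp σ.symm, hx0]
  have hX : IsPairCode (H := H) (r := r) X := by
    intro Y Y' S h T hT e
    have hl : ∀ i ∈ S.1, meetingMsg E (ZMod p) i Y = meetingMsg E (ZMod p) i Y' :=
      fun i hi => (Prod.ext_iff.1 (h i hi)).1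
    have hr' : ∀ σ : Equiv.Perm (Fin H), ∑ i ∈ S.1, x (val Y σ) (σ.symm i) =
        ∑ i ∈ S.1, x (val Y' σ) (σ.symm i) := fun σ =>
      Finset.sum_congr rfl fun i hi => congrFun (Prod.ext_iff.1 (h i hi)).2 σ
    by_cases hmeet : (S.1 ∩ T.1).Nonempty
    · exact ⟨eq_of_meetingMsg_eq hT.symm hmeet (Or.inl rfl) hl e,
        eq_of_meetingMsg_eq hT (by rwa [Finset.inter_comm]) (Or.inr rfl) hl e⟩
    · have hTS : T.1 = S.1ᶜ := by
        rw [Finset.not_nonempty_iff_eq_empty, ← Finset.disjoint_iff_inter_eq_empty] at hmeet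
        refine Finset.eq_of_subset_of_card_le
          (Finset.subset_compl_iff_disjoint_left.2 hmeet) ?_
        rw [Finset.card_compl, Fintype.card_fin, S.2, T.2]
        omega
      have hT1 : T = compl S := Subtype.ext hTS
      have hS1 : S = compl T := Subtype.ext (by simp [compl, hTS])
      constructor
      · rw [hT1, ← hsum Y S e, ← hsum Y' S e, hr']
      -- The zero total lets `S` compute the sum over the relays of `T`, to which it is not
      -- connected.
      · have hneg : ∀ (Y : User H r → User H r → E → ZMod p) (σ : Equiv.Perm (Fin H)),
            ∑ i ∈ T.1, x (val Y σ) (σ.symm i) = -∑ i ∈ S.1, x (val Y σ) (σ.symm i) :=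
          fun Y σ => by
            rw [hTS, eq_neg_iff_add_eq_zero, Finset.sum_compl_add_sum, htot]
        rw [hS1, ← hsum Y T e, ← hsum Y' T e, hneg, hneg, hr']
  refine ⟨fun h => (Nat.card {p : MeetingPair H r // commonRelay p = h} * Fintype.card E + H !) *
    (b + 1), ?_, ?_⟩
  · rw [← Finset.sum_mul, Finset.sum_add_distrib, ← Finset.sum_mul, sum_card_commonRelay,
      card_meetingPair_of_eq hr hH, hE]
    simp
  · have := (hasCode_of_isPairCode hX ι.injective
      (l := fun h => (Nat.card {p : MeetingPair H r // commonRelay p = h} * Fintype.card E + H !) *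
        (b + 1)) (fun h => by
        rw [Nat.card_prod, Nat.card_fun, Nat.card_fun, Nat.card_zmod, Nat.card_prod,
          Nat.card_perm, Nat.card_eq_fintype_card (α := Fin H), Fintype.card_fin,
          Nat.card_eq_fintype_card (α := E), ← pow_add, mul_comm (_ + _) (b + 1), pow_mul]
        exact Nat.pow_le_pow_left hp2 _) N).toFin
        (B := H.choose r * (2 * ((H - 1) * (r ! * (H - r)!))) * b) (by
          rw [Fintype.card_prod, Fintype.card_prod, Fintype.card_prod, hE, card_user,
            Fintype.card_bool, Fintype.card_fin]
          ring)
    rw [hE] at this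
    convert this using 1
    · ring
    · simp only [hE]

end PairCodes

end CombinationNetwork

/-! ### Memory sharing and the optimal loads -/

namespace CombinationNetwork

open Nat in
/-- Memory sharing between a family of codes in which each bit is cached by exactly one user and
uncoded delivery with empty caches. -/
lemma mem_achievableLoads_of_hasCode {H r N E L : ℕ} (hr : 1 ≤ r) (hrH : r ≤ H) (hN : 1 ≤ N)
    (hE : 1 ≤ E) (hL : L ≤ H.choose r * (H.choose r * E))
    (hcode : ∀ b, r ≤ b → ∃ l : Fin H → ℕ, ∑ h, l h = L * (b + 1) ∧
      HasCode H r N (Fin (H.choose r * E * b)) (N * (E * b)) l)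
    {M R : ℝ} (hM0 : 0 ≤ M) (hM : M ≤ N / (H.choose r : ℕ))
    (hR : ((H.choose r : ℕ) - (H.choose r : ℕ) * M / N *
      ((H.choose r : ℕ) - L / ((H.choose r : ℕ) * E)) : ℝ) < R * H) :
    R ∈ achievableLoads H r N M := by
  have hK : 0 < H.choose r := Nat.choose_pos hrH
  set K : ℕ := H.choose r with hKdef
  have hK0 : (0 : ℝ) < K := by exact_mod_cast hK
  have hN0 : (0 : ℝ) < N := by exact_mod_cast hN
  have hE0 : (0 : ℝ) < E := by exact_mod_cast hE
  set q : ℝ := K * M / N with hq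
  set μ : ℝ := L / (K * E) with hμ
  have hq0 : 0 ≤ q := by positivity
  have hq1 : q ≤ 1 := by
    rw [hq, div_le_one hN0]
    rw [le_div_iff₀ hK0] at hM
    linarith
  have hμK : μ ≤ K := by
    rw [hμ, div_le_iff₀ (by positivity)]
    exact_mod_cast hL
  have hμ0 : 0 ≤ μ := by positivity
  have hLμ : (L : ℝ) = μ * (K * E) := by
    rw [hμ]
    field_simp
  -- Here `μ` is the total load, in files, of the cached code without the field overhead. Rounding
  -- `q * n` down and the factor (n + 1)/n together cost at most K/n, which the strict slack in `hR`
  -- absorbs.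
  obtain ⟨n₀, hn₀⟩ := exists_nat_gt (K / (R * H - (K - q * (K - μ))))
  set n : ℕ := max n₀ r with hn
  have hnr : r ≤ n := le_max_right _ _
  have hn1 : (1 : ℝ) ≤ n := by exact_mod_cast hr.trans hnr
  have hnK : (K : ℝ) ≤ n * (R * H - (K - q * (K - μ))) := by
    rw [← div_le_iff₀ (by linarith)]
    exact hn₀.le.trans (by exact_mod_cast le_max_left _ _)
  set n₁ : ℕ := ⌊q * n⌋₊ with hn₁
  have h1 : (n₁ : ℝ) ≤ q * n := Nat.floor_le (by positivity)
  have h2 : q * n < n₁ + 1 := Nat.lt_floor_add_one _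
  have h3 : n₁ ≤ n := by
    have : (n₁ : ℝ) ≤ n := h1.trans (by nlinarith)
    exact_mod_cast this
  obtain ⟨l, hl, hc⟩ := hcode n hnr
  obtain ⟨l₀, hl₀, hc₀⟩ := hasCode_uncached (H := H) hr N n
  have hH : 1 ≤ H := hr.trans hrH
  have hfac : H ! = H * (H - 1)! := (Nat.mul_factorial_pred (by omega)).symm
  -- The factor `K * E` brings the uncached blocks to the size of the cached ones, so that a
  -- fraction n₁/n ≤ q of each file is cached.
  have hbig := (((hc₀.symmetrize hH).nsmul ((n - n₁) * (K * E))).sum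
    ((hc.symmetrize hH).nsmul n₁)).equiv finSumFinEquiv
  rw [hl, hl₀] at hbig
  have hB : (n - n₁) * (K * E) * (H ! * n) + n₁ * (H ! * (K * E * n)) = H ! * (K * E) * n * n := by
    obtain ⟨k, hk⟩ := Nat.exists_eq_add_of_le h3
    rw [hk, Nat.add_sub_cancel_left]
    ring
  rw [hB] at hbig
  refine hbig.mem_achievableLoads ?_ ?_ fun h => ?_
  · have : 0 < n := hr.trans hnr
    have := Nat.factorial_pos H
    exact Nat.succ_le_of_lt (by positivity)
  · have h4 : (n₁ : ℝ) * N ≤ M * K * n := by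
      have := mul_le_mul_of_nonneg_right h1 hN0.le
      rw [hq] at this
      calc (n₁ : ℝ) * N ≤ K * M / N * n * N := this
        _ = M * K * n := by field_simp
    push_cast
    have h5 : (0 : ℝ) ≤ (H ! : ℕ) * E * n := by positivity
    have h6 := mul_le_mul_of_nonneg_right h4 h5
    linarith
  · simp only [Pi.add_apply]
    push_cast [Nat.cast_sub h3]
    rw [hfac, hLμ]
    push_cast
    have h4 : ((n : ℝ) - n₁) * K * n + n₁ * μ * (n + 1) ≤ R * H * n * n := by
      have e1 : (q * n - n₁) * (n * (K - μ)) ≤ 1 * (n * (K - μ)) :=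
        mul_le_mul_of_nonneg_right (by linarith) (mul_nonneg (by linarith) (by linarith))
      have e2 : n₁ * μ ≤ n * μ := mul_le_mul_of_nonneg_right (by exact_mod_cast h3) hμ0
      have e3 := mul_le_mul_of_nonneg_left hnK (by linarith : (0 : ℝ) ≤ n)
      nlinarith
    have h5 : (0 : ℝ) ≤ ((H - 1)! : ℕ) * (K * E) := by positivity
    have h6 := mul_le_mul_of_nonneg_right h4 h5
    linarith

open Nat in
lemma isOptimalLoad_of_lt {H r N : ℕ} (hr : 1 ≤ r) (hrH : r ≤ H) (hH : H < 2 * r)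
    (hN : H.choose r ≤ N) {M : ℝ} (hM0 : 0 ≤ M) (hM : M ≤ N / (H.choose r : ℕ)) :
    IsOptimalLoad H r N M (((H.choose r : ℕ) : ℝ) / H -
      ((H.choose r : ℕ) + 1) / (2 * H) * ((H.choose r : ℕ) * M / N)) := by
  have hK : 0 < H.choose r := Nat.choose_pos hrH
  have hK0 : (0 : ℝ) < (H.choose r : ℕ) := by exact_mod_cast hK
  have hH0 : (0 : ℝ) < H := by exact_mod_cast hr.trans hrH
  refine ⟨fun R hR => lower_bound_of_lt hr hrH hN hR, fun x hx => le_of_forall_gt_imp_ge_of_dense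
    fun R hR => hx (mem_achievableLoads_of_hasCode (E := 2)
      (L := H.choose r * (H.choose r - 1)) hr hrH (hK.trans_le hN) one_le_two ?_
      (fun b hb => hasCode_cached_of_lt hH N b hb) hM0 hM ?_)⟩
  · exact Nat.mul_le_mul_left _ (by omega)
  · have h1 := mul_lt_mul_of_pos_right hR hH0
    refine lt_of_eq_of_lt ?_ h1
    rw [Nat.cast_mul, Nat.cast_sub hK]
    field_simp
    push_cast
    ring

open Nat in
lemma isOptimalLoad_of_eq {H r N : ℕ} (hr : 1 ≤ r) (hH : H = 2 * r)
    (hN : H.choose r ≤ N) {M : ℝ} (hM0 : 0 ≤ M) (hM : M ≤ N / (H.choose r : ℕ)) :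
    IsOptimalLoad H r N M ((((H.choose r : ℕ) : ℝ) * (H - 1) -
      (((H.choose r : ℕ) * H + H - (H.choose r : ℕ)) / 2 - 1) * ((H.choose r : ℕ) * M / N)) /
        (H * (H - 1))) := by
  have hrH : r ≤ H := by omega
  have hK : 0 < H.choose r := Nat.choose_pos hrH
  have hK0 : (0 : ℝ) < (H.choose r : ℕ) := by exact_mod_cast hK
  have hH2 : (2 : ℝ) ≤ H := by exact_mod_cast (by omega : 2 ≤ H)
  have hK2 : 2 ≤ H.choose r := by
    have h3 := Nat.choose_le_centralBinom 1 r
    rw [Nat.centralBinom, ← hH, Nat.choose_one_right] at h3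
    omega
  have hg : 0 < r ! * (H - r)! := by positivity
  have hfac : H ! = H.choose r * (r ! * (H - r)!) := by
    rw [← mul_assoc, Nat.choose_mul_factorial_mul_factorial hrH]
  obtain ⟨n, hn⟩ : ∃ n, H = n + 1 := ⟨H - 1, by omega⟩
  have hHn : (H : ℝ) = n + 1 := by exact_mod_cast hn
  have hn1 : 1 ≤ n := by omega
  have hn0 : (1 : ℝ) ≤ n := by linarith
  refine ⟨fun R hR => lower_bound_of_eq hr hH hN hR, fun x hx => le_of_forall_gt_imp_ge_of_dense
    fun R hR => hx (mem_achievableLoads_of_hasCode (E := 2 * ((H - 1) * (r ! * (H - r)!)))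
      (L := H.choose r * (H.choose r - 2) * ((H - 1) * (r ! * (H - r)!)) + H * H !)
      hr hrH (hK.trans_le hN) ?_ ?_ (fun b hb => hasCode_cached_of_eq hr hH N b hb) hM0 hM ?_)⟩
  · have : 0 < H - 1 := by omega
    exact Nat.succ_le_of_lt (by positivity)
  · rw [hfac]
    have h1 : H ≤ 2 * (H - 1) := by omega
    generalize r ! * (H - r)! = g
    obtain ⟨k, hk⟩ : ∃ k, H.choose r = k + 2 := ⟨H.choose r - 2, by omega⟩
    rw [hk, Nat.add_sub_cancel]
    calc (k + 2) * k * ((H - 1) * g) + H * ((k + 2) * g)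
        ≤ (k + 2) * k * ((H - 1) * g) + 2 * (H - 1) * ((k + 2) * g) := by gcongr
      _ = (k + 2) * ((k + 2) * ((H - 1) * g)) := by ring
      _ ≤ (k + 2) * ((k + 2) * (2 * ((H - 1) * g))) :=
        Nat.mul_le_mul_left _ (Nat.mul_le_mul_left _ (Nat.le_mul_of_pos_left _ two_pos))
  · have h1 := mul_lt_mul_of_pos_right hR (by linarith : (0 : ℝ) < H)
    refine lt_of_eq_of_lt ?_ h1
    have hg0 : (0 : ℝ) < (r ! * (H - r)! : ℕ) := by exact_mod_cast hg
    have hHs : ((H - 1 : ℕ) : ℝ) = n := by rw [hn, Nat.add_sub_cancel]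
    rw [hfac]
    generalize r ! * (H - r)! = g at hg0
    push_cast [Nat.cast_sub hK2]
    rw [hHs, hHn, add_sub_cancel_right]
    have hn0' : (0 : ℝ) < n := by linarith
    field_simp
    ring

end CombinationNetwork
theorem mainTheorem1 (H r N : ℕ) (hr : 1 ≤ r) (hrH : r ≤ H) (hH : H ≤ 2 * r)
    (K : ℕ) (hK : K = H.choose r) (hN : K ≤ N)
    (M : ℝ) (hM0 : 0 ≤ M) (hM : M ≤ (N : ℝ) / (K : ℝ)) :
    (H < 2 * r →
      CombinationNetwork.IsOptimalLoad H r N M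
        ((K : ℝ) / H - ((K : ℝ) + 1) / (2 * H) * (K * M / N))) ∧
    (H = 2 * r →
      CombinationNetwork.IsOptimalLoad H r N M
        (((K : ℝ) * ((H : ℝ) - 1) - (((K : ℝ) * H + H - K) / 2 - 1) * (K * M / N)) /
          ((H : ℝ) * ((H : ℝ) - 1)))) := by
  subst hK
  exact ⟨fun h => CombinationNetwork.isOptimalLoad_of_lt hr hrH h hN hM0 hM,
    fun h => CombinationNetwork.isOptimalLoad_of_eq hr h hN hM0 hM⟩
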